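/- Let $V$ be a category with finite limits and small coproducts, equipped with its cartesian monoidal structure $(\times,\mathbf 1)$, which is extensive: for every small family $(x_i)_{i\in I}$ the coproduct functor $\prod_i V/x_i\to V/\coprod_i x_i$ is an equivalence. $V$ need not be locally small, but assume that a small coproduct of objects each having only a set of arrows from $\mathbf 1$ again has only a set of arrows from $\mathbf 1$ (automatic if $V$ is locally small, or if the functor $V(\mathbf 1,-)$ preserves small coproducts). Definitions. For an internal category $A=(A_0,A_1,\partial_0,\partial_1,\iota,c)$ in $V$ ($\partial_0$ = domain, $\partial_1$ = codomain; $gf=c(g,f)$ is "$g$ after $f$") let $u\colon \mathrm{Idem}(A)\to A_1$ be the object of idempotent endo-arrows. A *splitting* of $A$ is a pair $R,S\colon\mathrm{Idem}(A)\to A_1$ with $\partial_0R=\partial_0u=\partial_1S$, $\partial_1R=\partial_0S$, $c(S,R)=u$ and $c(R,S)=\iota\partial_0S$. It is *canonical* if $R\iota^*=S\iota^*=\iota$, where $\iota^*\colon A_0\to\mathrm{Idem}(A)$ is induced by $\iota$, and if for all $f,g\colon T\to\mathrm{Idem}(A)$ that are idempotents on the same object with $fgf=g$, writing $k\colon T\to\mathrm{Idem}(A)$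 for the idempotent $(Rf)\,g\,(Sf)$, one has $Rk=(Rg)(Sf)$ and $Sk=(Rf)(Sg)$. Let $\mathrm{Cat}(V)^{s}_{\mathrm{Sp}}$ be the category whose objects are the internal categories $A$ equipped with a canonical splitting and such that the arrows $\mathbf 1\to A_1$ form a set, and whose arrows are the internal functors $F\colon A\to B$ with $F_1R_A=R_BF_1^*$ and $F_1S_A=S_BF_1^*$, where $F_1^*\colon\mathrm{Idem}(A)\to\mathrm{Idem}(B)$ is induced by $F_1$. Let $V\text{-}\mathrm{Cat}^{s}$ be the category of $V$-enriched categories $M$ with a set $M_0$ of objects and only a set of arrows $\mathbf 1\to M_{ab}$ for all $a,b\in M_0$, and of $V$-functors. The functor $\mathrm{En}'\colon\mathrm{Cat}(V)^{s}_{\mathrm{Sp}}\to V\text{-}\mathrm{Cat}^{s}$ sends $A$ to the $V$-category whose objects are the arrows $\mathbf 1\to A_0$, whose hom-object from $\alpha$ to $\beta$ is the pullback of $\langle\partial_0,\partial_1\rangle\colon A_1\to A_0\times A_0$ along $\langle\alpha,\beta\rangle\colon\mathbf 1\to A_0\times A_0$, with identities and composition induced by $\iota$ and $c$; it acts on internal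 functors in the evident way. For $M$ in $V\text{-}\mathrm{Cat}^{s}$ the internal category $\mathrm{Int}(M)$ is constructed as follows. $\mathrm{Int}(M)_0$ is the joint equalizer of the three arrows $\coprod_{a,b,c}M_{bc}\times M_{ab}\rightrightarrows\coprod_{a,b}M_{ab}$ induced by the two projections and the composition; it is the coproduct over $a\in M_0$ of the equalizers $\epsilon_a\colon\mathfrak M_a\to M_{aa}$ of $x\mapsto xx$ and the identity. $\mathrm{Int}(M)_1$ is the equalizer of the identity and the endomorphism of $\coprod_{a,b}\mathfrak M_b\times M_{ab}\times\mathfrak M_a$ given by $(d,f,e)\mapsto(d,dfe,e)$; it is the coproduct over $a,b$ of the corresponding equalizers of the components. In terms of generalized elements $(d,f,e)$ of these components, the domain is $e$, the codomain is $d$, the identity of $e$ is $(e,e,e)$, composition is $(k,g,d)(d,f,e)=(k,gf,e)$, and the chosen splitting sends an idempotent $(e,p,e)$ to the retraction $(p,p,e)$ and the section $(e,p,p)$. For a $V$-functor $F\colon M\to N$, $\mathrm{Int}(F)$ is given on components by $e\mapsto Fe$ and $(d,f,e)\mapsto(Fd,Ff,Fe)$. Theorem. These data define a functor $\mathrm{Int}\colon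 V\text{-}\mathrm{Cat}^{s}\to\mathrm{Cat}(V)^{s}_{\mathrm{Sp}}$, and $\mathrm{Int}$ is left adjoint to $\mathrm{En}'$. -/

import Mathlib

open CategoryTheory CategoryTheory.Limits MonoidalCategory CartesianMonoidalCategory

/- Arrows of a category are written through its category structure, not through the reflexive
quiver underlying it. -/
attribute [-instance] CategoryTheory.catToReflQuiver

universe w v u

noncomputable section

namespace IntEn

/-! ## Extensive categories -/

section Extensive

variable {V : Type u} [Category.{v} V] [HasCoproducts.{w} V]

/-- The coproduct functor from the product of the slices over the `x i` to the slice
over `∐ x`. -/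
@[simps]
def coprodOver {I : Type w} (x : I → V) : (∀ i, Over (x i)) ⥤ Over (∐ x) where
  obj f := Over.mk (Limits.Sigma.map (fun i => (f i).hom))
  map {f g} k := Over.homMk (Limits.Sigma.map (fun i => (k i).left)) (by
    dsimp
    rw [Sigma.map_comp_map]
    congr 1
    funext i
    simp)
  map_id f := by
    ext
    simp
  map_comp k l := by
    ext
    simp [Sigma.map_comp_map]

variable (V) in
/-- A category with small coproducts is extensive if all the coproduct functors between slices
are equivalences of categories. -/
class Extensive : Prop where
  isEquivalence : ∀ (I : Type w) (x : I → V), (coprodOver x).IsEquivalence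

end Extensive

/-! ## Internal categories and internal functors -/

section Internal

variable (V : Type u) [Category.{v} V] [HasPullbacks V]

/-- The data of an internal category, without the axioms. The object of composable arrows is the
pullback of `dom` along `cod`: its generalized elements are the pairs `(g, f)` with
`dom g = cod f`, and `comp` sends such a pair to "`g` after `f`". -/
structure InternalCategoryData where
  /-- the object of objects -/
  obj : V
  /-- the object of arrows -/
  arr : V
  dom : arr ⟶ obj
  cod : arr ⟶ obj
  ident : obj ⟶ arr
  comp : pullback dom cod ⟶ arr

variable {V} in
/-- The composite "`g` after `f`" of two composable generalized arrows. -/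
def InternalCategoryData.compose (A : InternalCategoryData V) {T : V} (g f : T ⟶ A.arr)
    (h : g ≫ A.dom = f ≫ A.cod) : T ⟶ A.arr :=
  pullback.lift g f h ≫ A.comp

/-- Categories internal to `V`. -/
structure InternalCategory extends InternalCategoryData V where
  ident_dom : ident ≫ dom = 𝟙 obj
  ident_cod : ident ≫ cod = 𝟙 obj
  comp_dom : comp ≫ dom = pullback.snd dom cod ≫ dom
  comp_cod : comp ≫ cod = pullback.fst dom cod ≫ cod
  ident_comp : ∀ h : (cod ≫ ident) ≫ dom = 𝟙 arr ≫ cod,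
    toInternalCategoryData.compose (cod ≫ ident) (𝟙 arr) h = 𝟙 arr
  comp_ident : ∀ h : 𝟙 arr ≫ dom = (dom ≫ ident) ≫ cod,
    toInternalCategoryData.compose (𝟙 arr) (dom ≫ ident) h = 𝟙 arr
  assoc : ∀ {T : V} (k g f : T ⟶ arr) (hkg : k ≫ dom = g ≫ cod) (hgf : g ≫ dom = f ≫ cod)
    (h₁ : toInternalCategoryData.compose k g hkg ≫ dom = f ≫ cod)
    (h₂ : k ≫ dom = toInternalCategoryData.compose g f hgf ≫ cod),
    toInternalCategoryData.compose (toInternalCategoryData.compose k g hkg) f h₁ =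
      toInternalCategoryData.compose k (toInternalCategoryData.compose g f hgf) h₂

variable {V}

namespace InternalCategory

variable (A : InternalCategory V) {T T' : V}

lemma compose_dom (g f : T ⟶ A.arr) (h : g ≫ A.dom = f ≫ A.cod) :
    A.compose g f h ≫ A.dom = f ≫ A.dom := by
  simp [InternalCategoryData.compose, A.comp_dom, pullback.lift_snd_assoc]

lemma compose_cod (g f : T ⟶ A.arr) (h : g ≫ A.dom = f ≫ A.cod) :
    A.compose g f h ≫ A.cod = g ≫ A.cod := by
  simp [InternalCategoryData.compose, A.comp_cod, pullback.lift_fst_assoc]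

lemma comp_compose (k : T' ⟶ T) (g f : T ⟶ A.arr) (h : g ≫ A.dom = f ≫ A.cod) :
    k ≫ A.compose g f h = A.compose (k ≫ g) (k ≫ f) (by simp [h]) := by
  simp only [InternalCategoryData.compose, ← Category.assoc]
  congr 1
  ext <;> simp [pullback.lift_fst, pullback.lift_snd]

lemma compose_congr {g g' f f' : T ⟶ A.arr} (h : g ≫ A.dom = f ≫ A.cod) (hg : g = g')
    (hf : f = f') : A.compose g f h = A.compose g' f' (by rw [← hg, ← hf, h]) := by
  subst hg hf
  rfl

lemma ident_compose (e f : T ⟶ A.arr) (h : e ≫ A.dom = f ≫ A.cod)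
    (he : e = f ≫ A.cod ≫ A.ident) : A.compose e f h = f := by
  have h₁ := A.comp_compose f (A.cod ≫ A.ident) (𝟙 _) (by simp [A.ident_dom])
  rw [A.ident_comp] at h₁
  exact (A.compose_congr _ he (by simp)).trans (h₁.symm.trans (by simp))

lemma compose_ident (f e : T ⟶ A.arr) (h : f ≫ A.dom = e ≫ A.cod)
    (he : e = f ≫ A.dom ≫ A.ident) : A.compose f e h = f := by
  have h₁ := A.comp_compose f (𝟙 _) (A.dom ≫ A.ident) (by simp [A.ident_cod])
  rw [A.comp_ident] at h₁
  exact (A.compose_congr _ (by simp) he).trans (h₁.symm.trans (by simp))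

end InternalCategory

/-- Internal functors. -/
@[ext]
structure InternalFunctor (A B : InternalCategory V) where
  onObj : A.obj ⟶ B.obj
  onArr : A.arr ⟶ B.arr
  dom : onArr ≫ B.dom = A.dom ≫ onObj
  cod : onArr ≫ B.cod = A.cod ≫ onObj
  ident : A.ident ≫ onArr = onObj ≫ B.ident
  comp : ∀ h : (pullback.fst A.dom A.cod ≫ onArr) ≫ B.dom =
      (pullback.snd A.dom A.cod ≫ onArr) ≫ B.cod,
    A.comp ≫ onArr =
      B.compose (pullback.fst A.dom A.cod ≫ onArr) (pullback.snd A.dom A.cod ≫ onArr) h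

namespace InternalFunctor

variable {A B C : InternalCategory V} {T : V}

lemma composable (F : InternalFunctor A B) (g f : T ⟶ A.arr) (h : g ≫ A.dom = f ≫ A.cod) :
    (g ≫ F.onArr) ≫ B.dom = (f ≫ F.onArr) ≫ B.cod := by
  simp only [Category.assoc, F.dom, F.cod]
  rw [← Category.assoc, h, Category.assoc]

lemma compose_onArr (F : InternalFunctor A B) (g f : T ⟶ A.arr) (h : g ≫ A.dom = f ≫ A.cod) :
    A.compose g f h ≫ F.onArr =
      B.compose (g ≫ F.onArr) (f ≫ F.onArr) (F.composable g f h) := by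
  rw [InternalCategoryData.compose, Category.assoc,
    F.comp (F.composable _ _ pullback.condition), B.comp_compose]
  exact B.compose_congr _ (by simp [pullback.lift_fst_assoc]) (by simp [pullback.lift_snd_assoc])

/-- The identity internal functor. -/
@[simps]
def id (A : InternalCategory V) : InternalFunctor A A where
  onObj := 𝟙 _
  onArr := 𝟙 _
  dom := by simp
  cod := by simp
  ident := by simp
  comp h := by
    have h₁ := A.comp_compose (𝟙 _) (pullback.fst A.dom A.cod) (pullback.snd A.dom A.cod)
      pullback.condition
    have h₂ : A.compose (pullback.fst A.dom A.cod) (pullback.snd A.dom A.cod)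
        pullback.condition = A.comp := by
      rw [InternalCategoryData.compose, ← Category.id_comp A.comp]
      simp only [← Category.assoc]
      congr 1
      ext <;> simp
    rw [← h₂, Category.comp_id]
    exact A.compose_congr _ (by simp) (by simp)

/-- Composition of internal functors. -/
@[simps]
def trans (F : InternalFunctor A B) (G : InternalFunctor B C) : InternalFunctor A C where
  onObj := F.onObj ≫ G.onObj
  onArr := F.onArr ≫ G.onArr
  dom := by simp [G.dom, reassoc_of% F.dom]
  cod := by simp [G.cod, reassoc_of% F.cod]
  ident := by simp [← G.ident, reassoc_of% F.ident]
  comp h := by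
    rw [← Category.assoc, F.comp (F.composable _ _ pullback.condition), G.compose_onArr]
    exact C.compose_congr _ (by simp) (by simp)

end InternalFunctor

/-- The category of categories internal to `V`. -/
instance : Category (InternalCategory V) where
  Hom := InternalFunctor
  id := InternalFunctor.id
  comp := InternalFunctor.trans
  id_comp F := by apply InternalFunctor.ext <;> simp
  comp_id F := by apply InternalFunctor.ext <;> simp
  assoc F G H := by apply InternalFunctor.ext <;> simp

end Internal

/-! ## Splitting of idempotents in internal categories -/

section Splitting

variable {V : Type u} [Category.{v} V] [HasFiniteLimits V]

namespace InternalCategory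

variable (A : InternalCategory V) {T : V}

/-- The object of endoarrows. -/
abbrev endo : V := equalizer A.dom A.cod

/-- The inclusion of the endoarrows into the arrows. -/
abbrev endoι : A.endo ⟶ A.arr := equalizer.ι A.dom A.cod

lemma endoι_condition : A.endoι ≫ A.dom = A.endoι ≫ A.cod := equalizer.condition _ _

/-- The arrow sending an endoarrow `e` to `e` composed with itself. -/
def endoSq : A.endo ⟶ A.endo :=
  equalizer.lift (A.compose A.endoι A.endoι A.endoι_condition) (by
    rw [compose_dom, compose_cod, endoι_condition])

/-- The object of idempotents. -/
abbrev idem : V := equalizer A.endoSq (𝟙 A.endo)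

/-- The inclusion of the idempotents into the arrows. -/
def idemι : A.idem ⟶ A.arr := equalizer.ι A.endoSq (𝟙 A.endo) ≫ A.endoι

lemma idemι_condition : A.idemι ≫ A.dom = A.idemι ≫ A.cod := by
  simp [idemι, endoι_condition]

lemma idemι_idem : A.compose A.idemι A.idemι A.idemι_condition = A.idemι := by
  have h := equalizer.condition A.endoSq (𝟙 A.endo)
  have h' := congrArg (· ≫ A.endoι) h
  simp only [endoSq, Category.assoc, endoι, equalizer.lift_ι, Category.comp_id] at h'
  rw [A.comp_compose] at h'
  exact h'

/-- A generalized idempotent arrow induces a generalized element of the object of idempotents. -/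
def idemLift (e : T ⟶ A.arr) (h : e ≫ A.dom = e ≫ A.cod) (he : A.compose e e h = e) :
    T ⟶ A.idem :=
  equalizer.lift (equalizer.lift e h) (by
    apply equalizer.hom_ext
    simp only [endoSq, Category.assoc, equalizer.lift_ι, Category.comp_id]
    rw [A.comp_compose]
    exact (A.compose_congr _ (by simp [endoι]) (by simp [endoι])).trans he)

@[simp]
lemma idemLift_ι (e : T ⟶ A.arr) (h : e ≫ A.dom = e ≫ A.cod) (he : A.compose e e h = e) :
    A.idemLift e h he ≫ A.idemι = e := by
  simp [idemLift, idemι, endoι]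

@[simp]
lemma idemLift_ι_assoc {W : V} (e : T ⟶ A.arr) (h : e ≫ A.dom = e ≫ A.cod)
    (he : A.compose e e h = e) (k : A.arr ⟶ W) :
    A.idemLift e h he ≫ A.idemι ≫ k = e ≫ k := by
  rw [← Category.assoc, idemLift_ι]

lemma idem_hom_ext {f g : T ⟶ A.idem} (h : f ≫ A.idemι = g ≫ A.idemι) : f = g := by
  apply equalizer.hom_ext
  apply equalizer.hom_ext
  simpa [idemι, endoι] using h

/-- Identities are idempotents. -/
def identIdem : A.obj ⟶ A.idem :=
  A.idemLift A.ident (by rw [A.ident_dom, A.ident_cod])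
    (A.ident_compose _ _ _ (by simp [reassoc_of% A.ident_cod]))

/-- A choice of a splitting of all the idempotents: the retraction `R` and the section `S`. -/
structure Splitting where
  R : A.idem ⟶ A.arr
  S : A.idem ⟶ A.arr
  R_dom : R ≫ A.dom = A.idemι ≫ A.dom
  S_cod : S ≫ A.cod = A.idemι ≫ A.dom
  R_cod : R ≫ A.cod = S ≫ A.dom
  S_comp_R : ∀ h : S ≫ A.dom = R ≫ A.cod, A.compose S R h = A.idemι
  R_comp_S : ∀ h : R ≫ A.dom = S ≫ A.cod, A.compose R S h = (S ≫ A.dom) ≫ A.ident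

/-- A splitting is canonical if identities split through themselves and, whenever `f` and `g` are
idempotents with `f g f = g`, the idempotent `r_f g s_f` splits as `r_g s_f` followed
by `r_f s_g`. -/
structure Splitting.IsCanonical {A : InternalCategory V} (σ : A.Splitting) : Prop where
  ident_R : A.identIdem ≫ σ.R = A.ident
  ident_S : A.identIdem ≫ σ.S = A.ident
  R_eq : ∀ {T : V} (f g k : T ⟶ A.idem)
    (_hfg : (f ≫ A.idemι) ≫ A.dom = (g ≫ A.idemι) ≫ A.cod)
    (hgf : (g ≫ A.idemι) ≫ A.dom = (f ≫ A.idemι) ≫ A.cod)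
    (hfgf : (f ≫ A.idemι) ≫ A.dom = A.compose (g ≫ A.idemι) (f ≫ A.idemι) hgf ≫ A.cod)
    (hgs : (g ≫ A.idemι) ≫ A.dom = (f ≫ σ.S) ≫ A.cod)
    (hrgs : (f ≫ σ.R) ≫ A.dom = A.compose (g ≫ A.idemι) (f ≫ σ.S) hgs ≫ A.cod)
    (hrs : (g ≫ σ.R) ≫ A.dom = (f ≫ σ.S) ≫ A.cod),
    A.compose (f ≫ A.idemι) (A.compose (g ≫ A.idemι) (f ≫ A.idemι) hgf) hfgf =
      g ≫ A.idemι →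
    k ≫ A.idemι = A.compose (f ≫ σ.R) (A.compose (g ≫ A.idemι) (f ≫ σ.S) hgs) hrgs →
    k ≫ σ.R = A.compose (g ≫ σ.R) (f ≫ σ.S) hrs
  S_eq : ∀ {T : V} (f g k : T ⟶ A.idem)
    (_hfg : (f ≫ A.idemι) ≫ A.dom = (g ≫ A.idemι) ≫ A.cod)
    (hgf : (g ≫ A.idemι) ≫ A.dom = (f ≫ A.idemι) ≫ A.cod)
    (hfgf : (f ≫ A.idemι) ≫ A.dom = A.compose (g ≫ A.idemι) (f ≫ A.idemι) hgf ≫ A.cod)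
    (hgs : (g ≫ A.idemι) ≫ A.dom = (f ≫ σ.S) ≫ A.cod)
    (hrgs : (f ≫ σ.R) ≫ A.dom = A.compose (g ≫ A.idemι) (f ≫ σ.S) hgs ≫ A.cod)
    (hrs : (f ≫ σ.R) ≫ A.dom = (g ≫ σ.S) ≫ A.cod),
    A.compose (f ≫ A.idemι) (A.compose (g ≫ A.idemι) (f ≫ A.idemι) hgf) hfgf =
      g ≫ A.idemι →
    k ≫ A.idemι = A.compose (f ≫ σ.R) (A.compose (g ≫ A.idemι) (f ≫ σ.S) hgs) hrgs →
    k ≫ σ.S = A.compose (f ≫ σ.R) (g ≫ σ.S) hrs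

end InternalCategory

/-- The arrow between the objects of idempotents induced by an internal functor. -/
def InternalFunctor.onIdem {A B : InternalCategory V} (F : InternalFunctor A B) :
    A.idem ⟶ B.idem :=
  B.idemLift (A.idemι ≫ F.onArr) (F.composable _ _ A.idemι_condition) (by
    rw [← F.compose_onArr _ _ A.idemι_condition, A.idemι_idem])

@[simp]
lemma InternalFunctor.onIdem_ι {A B : InternalCategory V} (F : InternalFunctor A B) :
    F.onIdem ≫ B.idemι = A.idemι ≫ F.onArr := by
  simp [InternalFunctor.onIdem]

@[simp]
lemma InternalFunctor.onIdem_ι_assoc {A B : InternalCategory V} (F : InternalFunctor A B) {W : V}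
    (k : B.arr ⟶ W) : F.onIdem ≫ B.idemι ≫ k = A.idemι ≫ F.onArr ≫ k := by
  rw [← Category.assoc, F.onIdem_ι, Category.assoc]

end Splitting

/-! ## The category of small internal categories that split idempotents canonically -/

section CatSp

variable (V : Type u) [Category.{v} V] [CartesianMonoidalCategory V] [HasFiniteLimits V]

/-- Internal categories with a canonical splitting of the idempotents and with only a `w`-small
set of arrows `1 ⟶ A₁`. -/
structure CatSp extends InternalCategory V where
  splitting : toInternalCategory.Splitting
  canonical : splitting.IsCanonical
  small : Small.{w} (𝟙_ V ⟶ arr)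

variable {V}

/-- Internal functors preserving the chosen splittings. -/
@[ext]
structure CatSp.Hom (A B : CatSp.{w} V) extends
    InternalFunctor A.toInternalCategory B.toInternalCategory where
  map_R : A.splitting.R ≫ onArr = toInternalFunctor.onIdem ≫ B.splitting.R
  map_S : A.splitting.S ≫ onArr = toInternalFunctor.onIdem ≫ B.splitting.S

/-- The category of internal categories with a canonical splitting of the idempotents (and a size
restriction) and of internal functors preserving the splittings. -/
instance : Category (CatSp.{w} V) where
  Hom := CatSp.Hom
  id A :=
    { InternalFunctor.id A.toInternalCategory with
      map_R := by
        have : (InternalFunctor.id A.toInternalCategory).onIdem = 𝟙 _ :=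
          InternalCategory.idem_hom_ext _ (by simp)
        rw [this]
        simp
      map_S := by
        have : (InternalFunctor.id A.toInternalCategory).onIdem = 𝟙 _ :=
          InternalCategory.idem_hom_ext _ (by simp)
        rw [this]
        simp }
  comp {A B C} F G :=
    { F.toInternalFunctor.trans G.toInternalFunctor with
      map_R := by
        have : (F.toInternalFunctor.trans G.toInternalFunctor).onIdem =
            F.toInternalFunctor.onIdem ≫ G.toInternalFunctor.onIdem :=
          InternalCategory.idem_hom_ext _ (by simp)
        rw [this]
        simp [reassoc_of% F.map_R, G.map_R]
      map_S := by
        have : (F.toInternalFunctor.trans G.toInternalFunctor).onIdem =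
            F.toInternalFunctor.onIdem ≫ G.toInternalFunctor.onIdem :=
          InternalCategory.idem_hom_ext _ (by simp)
        rw [this]
        simp [reassoc_of% F.map_S, G.map_S] }
  id_comp F := by apply CatSp.Hom.ext <;> simp
  comp_id F := by apply CatSp.Hom.ext <;> simp
  assoc F G H := by apply CatSp.Hom.ext <;> simp

end CatSp

/-! ## The category of small enriched categories -/

section VCat

variable (V : Type u) [Category.{v} V] [CartesianMonoidalCategory V]

/-- `V`-enriched categories with a `w`-small set of objects and `w`-small sets of arrows
`1 ⟶ M(a, b)`. -/
structure VCat where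
  carrier : Type w
  [enriched : EnrichedCategory V carrier]
  small : ∀ a b : carrier, Small.{w} (𝟙_ V ⟶ (a ⟶[V] b))

attribute [instance] VCat.enriched

/-- The category of (small) `V`-enriched categories and enriched functors. -/
instance : Category (VCat.{w} V) where
  Hom M N := EnrichedFunctor V M.carrier N.carrier
  id M := EnrichedFunctor.id V M.carrier
  comp F G := F.comp V G
  id_comp _ := EnrichedFunctor.ext V (fun _ => rfl)
    (fun _ _ => (Category.comp_id _).trans (Category.id_comp _))
  comp_id _ := EnrichedFunctor.ext V (fun _ => rfl)
    (fun _ _ => (Category.comp_id _).trans (Category.comp_id _))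
  assoc _ _ _ := EnrichedFunctor.ext V (fun _ => rfl)
    (fun _ _ => (Category.comp_id _).trans (Category.assoc _ _ _))

end VCat

/-! ## The functor from internal categories to enriched categories -/

section En

variable {V : Type u} [Category.{v} V] [CartesianMonoidalCategory V] [HasFiniteLimits V]

namespace InternalCategory

variable (A : InternalCategory V) {T : V}

/-- The object of the arrows of `A` from the global object `α` to the global object `β`. -/
abbrev Γ (α β : 𝟙_ V ⟶ A.obj) : V :=
  pullback (lift A.dom A.cod) (lift α β)

/-- The inclusion into the object of arrows. -/
abbrev up (α β : 𝟙_ V ⟶ A.obj) : A.Γ α β ⟶ A.arr :=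
  pullback.fst (lift A.dom A.cod) (lift α β)

lemma up_dom (α β : 𝟙_ V ⟶ A.obj) : A.up α β ≫ A.dom = toUnit _ ≫ α := by
  have h := congrArg (· ≫ fst _ _) (pullback.condition (f := lift A.dom A.cod) (g := lift α β))
  simp only [Category.assoc, lift_fst] at h
  rw [h]
  congr 1
  exact toUnit_unique _ _

lemma up_cod (α β : 𝟙_ V ⟶ A.obj) : A.up α β ≫ A.cod = toUnit _ ≫ β := by
  have h := congrArg (· ≫ snd _ _) (pullback.condition (f := lift A.dom A.cod) (g := lift α β))
  simp only [Category.assoc, lift_snd] at h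
  rw [h]
  congr 1
  exact toUnit_unique _ _

lemma comp_up_dom {α β : 𝟙_ V ⟶ A.obj} (f : T ⟶ A.Γ α β) :
    (f ≫ A.up α β) ≫ A.dom = toUnit _ ≫ α := by
  rw [Category.assoc, up_dom, ← Category.assoc, comp_toUnit]

lemma comp_up_cod {α β : 𝟙_ V ⟶ A.obj} (f : T ⟶ A.Γ α β) :
    (f ≫ A.up α β) ≫ A.cod = toUnit _ ≫ β := by
  rw [Category.assoc, up_cod, ← Category.assoc, comp_toUnit]

lemma Γ_hom_ext {α β : 𝟙_ V ⟶ A.obj} {f g : T ⟶ A.Γ α β}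
    (h : f ≫ A.up α β = g ≫ A.up α β) : f = g :=
  pullback.hom_ext h (toUnit_unique _ _)

/-- A generalized arrow from `α` to `β` is a generalized element of `A.Γ α β`. -/
def Γlift {α β : 𝟙_ V ⟶ A.obj} (f : T ⟶ A.arr) (hd : f ≫ A.dom = toUnit _ ≫ α)
    (hc : f ≫ A.cod = toUnit _ ≫ β) : T ⟶ A.Γ α β :=
  pullback.lift f (toUnit _) (by rw [comp_lift, comp_lift, hd, hc])

@[simp]
lemma Γlift_up {α β : 𝟙_ V ⟶ A.obj} (f : T ⟶ A.arr) (hd : f ≫ A.dom = toUnit _ ≫ α)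
    (hc : f ≫ A.cod = toUnit _ ≫ β) : A.Γlift f hd hc ≫ A.up α β = f :=
  pullback.lift_fst _ _ _

@[simp]
lemma Γlift_up_assoc {α β : 𝟙_ V ⟶ A.obj} {W : V} (f : T ⟶ A.arr)
    (hd : f ≫ A.dom = toUnit _ ≫ α) (hc : f ≫ A.cod = toUnit _ ≫ β) (k : A.arr ⟶ W) :
    A.Γlift f hd hc ≫ A.up α β ≫ k = f ≫ k := by
  rw [← Category.assoc, Γlift_up]

/-- The identity arrow at `α`. -/
def Γident (α : 𝟙_ V ⟶ A.obj) : 𝟙_ V ⟶ A.Γ α α :=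
  A.Γlift (α ≫ A.ident) (by simp [A.ident_dom]) (by simp [A.ident_cod])

/-- Composition of arrows. -/
def Γcomp (α β γ : 𝟙_ V ⟶ A.obj) : A.Γ α β ⊗ A.Γ β γ ⟶ A.Γ α γ :=
  A.Γlift
    (A.compose (snd _ _ ≫ A.up β γ) (fst _ _ ≫ A.up α β) (by rw [comp_up_dom, comp_up_cod]))
    (by rw [compose_dom, comp_up_dom]) (by rw [compose_cod, comp_up_cod])

lemma comp_Γcomp_up {α β γ : 𝟙_ V ⟶ A.obj} (k : T ⟶ A.Γ α β ⊗ A.Γ β γ) :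
    (k ≫ A.Γcomp α β γ) ≫ A.up α γ =
      A.compose ((k ≫ snd _ _) ≫ A.up β γ) ((k ≫ fst _ _) ≫ A.up α β)
        (by rw [comp_up_dom, comp_up_cod]) := by
  rw [Category.assoc, Γcomp, Γlift_up, A.comp_compose]
  exact A.compose_congr _ (by simp) (by simp)

end InternalCategory

/-- The action of an internal functor on objects of arrows. -/
def InternalFunctor.Γmap {A B : InternalCategory V} (F : InternalFunctor A B)
    {α β : 𝟙_ V ⟶ A.obj} {α' β' : 𝟙_ V ⟶ B.obj} (hα : α' = α ≫ F.onObj)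
    (hβ : β' = β ≫ F.onObj) : A.Γ α β ⟶ B.Γ α' β' :=
  B.Γlift (A.up α β ≫ F.onArr)
    (by simp [F.dom, reassoc_of% A.up_dom, hα]) (by simp [F.cod, reassoc_of% A.up_cod, hβ])

@[simp]
lemma InternalFunctor.Γmap_up {A B : InternalCategory V} (F : InternalFunctor A B)
    {α β : 𝟙_ V ⟶ A.obj} {α' β' : 𝟙_ V ⟶ B.obj} (hα : α' = α ≫ F.onObj)
    (hβ : β' = β ≫ F.onObj) : F.Γmap hα hβ ≫ B.up α' β' = A.up α β ≫ F.onArr :=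
  B.Γlift_up _ _ _

@[simp]
lemma InternalFunctor.Γmap_up_assoc {A B : InternalCategory V} (F : InternalFunctor A B)
    {α β : 𝟙_ V ⟶ A.obj} {α' β' : 𝟙_ V ⟶ B.obj} (hα : α' = α ≫ F.onObj)
    (hβ : β' = β ≫ F.onObj) {W : V} (k : B.arr ⟶ W) :
    F.Γmap hα hβ ≫ B.up α' β' ≫ k = A.up α β ≫ F.onArr ≫ k := by
  rw [← Category.assoc, F.Γmap_up, Category.assoc]

namespace CatSp

variable (A : CatSp.{w} V)

instance : Small.{w} (𝟙_ V ⟶ A.obj) :=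
  haveI := A.small
  small_of_injective (β := 𝟙_ V ⟶ A.arr) (f := fun α => α ≫ A.ident) (fun α β h => by
    have := congrArg (· ≫ A.dom) h
    simpa [A.ident_dom] using this)

/-- The set of global objects of `A`. -/
def Points : Type w := Shrink.{w} (𝟙_ V ⟶ A.obj)

variable {A}

/-- The global object of `A` that an element of `A.Points` stands for. -/
def Points.pt (α : A.Points) : 𝟙_ V ⟶ A.obj := (equivShrink _).symm α

/-- The element of `A.Points` standing for a global object. -/
def Points.mk (α : 𝟙_ V ⟶ A.obj) : A.Points := equivShrink _ α

@[simp]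
lemma Points.pt_mk (α : 𝟙_ V ⟶ A.obj) : (Points.mk α).pt = α := by
  simp [Points.pt, Points.mk]

@[simp]
lemma Points.mk_pt (α : A.Points) : Points.mk α.pt = α :=
  (equivShrink _).apply_symm_apply α

variable (A)

open InternalCategory in
/-- The `V`-enriched category of the global objects of `A`. -/
instance : EnrichedCategory V A.Points where
  Hom α β := A.Γ α.pt β.pt
  id α := A.Γident α.pt
  comp α β γ := A.Γcomp α.pt β.pt γ.pt
  id_comp α β := A.Γ_hom_ext (by
    rw [← Category.assoc, comp_Γcomp_up, Category.id_comp]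
    refine (A.compose_ident _ _ _ ?_).trans ?_
    · simp [Γident, reassoc_of% A.up_dom]
    · simp)
  comp_id α β := A.Γ_hom_ext (by
    rw [← Category.assoc, comp_Γcomp_up, Category.id_comp]
    refine (A.ident_compose _ _ _ ?_).trans ?_
    · simp [Γident, reassoc_of% A.up_cod]
    · simp)
  assoc α β γ δ := A.Γ_hom_ext (by
    rw [← Category.assoc, comp_Γcomp_up, comp_Γcomp_up]
    have h₁ : ((((α_ (A.Γ α.pt β.pt) (A.Γ β.pt γ.pt) (A.Γ γ.pt δ.pt)).inv ≫
        A.Γcomp α.pt β.pt γ.pt ▷ _) ≫ fst _ _) ≫ A.up _ _) =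
        A.compose ((snd _ _ ≫ fst _ _) ≫ A.up _ _) (fst _ _ ≫ A.up _ _)
          (by rw [comp_up_dom, comp_up_cod]) := by
      rw [Category.assoc _ _ (fst _ _), whiskerRight_fst, ← Category.assoc, comp_Γcomp_up]
      exact A.compose_congr _ (by simp) (by simp)
    have h₂ : ((A.Γ α.pt β.pt ◁ A.Γcomp β.pt γ.pt δ.pt ≫ snd _ _) ≫ A.up _ _) =
        A.compose ((snd _ _ ≫ snd _ _) ≫ A.up _ _) ((snd _ _ ≫ fst _ _) ≫ A.up _ _)
          (by rw [comp_up_dom, comp_up_cod]) := by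
      rw [whiskerLeft_snd, comp_Γcomp_up]
    refine (A.compose_congr _ (g' := (snd _ _ ≫ snd _ _) ≫ A.up _ _) (by simp) h₁).trans
      (Eq.trans ?_ (A.compose_congr _ h₂
        (f' := fst _ _ ≫ A.up _ _) (by simp)).symm)
    exact (A.assoc _ _ _ _ _ _ _).symm)

lemma eHom_def (α β : A.Points) : (α ⟶[V] β) = A.Γ α.pt β.pt := rfl

instance (α β : A.Points) : Small.{w} (𝟙_ V ⟶ A.Γ α.pt β.pt) :=
  haveI := A.small
  small_of_injective (β := 𝟙_ V ⟶ A.arr) (f := fun k => k ≫ A.up _ _)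
    (fun _ _ h => A.Γ_hom_ext h)

open InternalCategory in
/-- The enriched functor induced by an internal functor. -/
def Hom.enriched {A B : CatSp.{w} V} (F : CatSp.Hom A B) :
    EnrichedFunctor V A.Points B.Points where
  obj α := Points.mk (α.pt ≫ F.onObj)
  map α β := F.Γmap (Points.pt_mk _) (Points.pt_mk _)
  map_id α := B.Γ_hom_ext (by
    change (A.Γident α.pt ≫ F.Γmap _ _) ≫ _ = B.Γident _ ≫ _
    simp [Γident, F.ident])
  map_comp α β γ := B.Γ_hom_ext (by
    change (A.Γcomp α.pt β.pt γ.pt ≫ F.Γmap _ _) ≫ _ =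
      ((F.Γmap _ _ ⊗ₘ F.Γmap _ _) ≫ B.Γcomp _ _ _) ≫ _
    rw [Category.assoc, F.Γmap_up, Γcomp, Γlift_up_assoc, F.compose_onArr, comp_Γcomp_up]
    exact B.compose_congr _ (by simp) (by simp))

lemma eqToHom_up (A : InternalCategory V) {α β α' β' : 𝟙_ V ⟶ A.obj} (hα : α = α')
    (hβ : β = β') (h : A.Γ α β = A.Γ α' β') : eqToHom h ≫ A.up α' β' = A.up α β := by
  subst hα hβ
  simp

/-- The small `V`-enriched category of the global objects of `A`. -/
@[simps]
def toVCat (A : CatSp.{w} V) : VCat.{w} V where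
  carrier := A.Points
  small α β := inferInstanceAs (Small.{w} (𝟙_ V ⟶ A.Γ α.pt β.pt))

lemma enriched_ext {M : VCat.{w} V} {A : CatSp.{w} V} {F G : EnrichedFunctor V M.carrier A.Points}
    (hobj : ∀ a, F.obj a = G.obj a)
    (hmap : ∀ a b, F.map a b ≫ A.up (F.obj a).pt (F.obj b).pt =
      G.map a b ≫ A.up (G.obj a).pt (G.obj b).pt) : F = G :=
  EnrichedFunctor.ext V hobj (fun a b => A.Γ_hom_ext (by
    rw [← hmap, Category.assoc]
    congr 1
    exact eqToHom_up _ (by rw [hobj]) (by rw [hobj]) _))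

end CatSp

variable (V) in
/-- The functor sending an internal category to the enriched category of its global objects. -/
def En : CatSp.{w} V ⥤ VCat.{w} V where
  obj A := A.toVCat
  map F := CatSp.Hom.enriched F
  map_id A := CatSp.enriched_ext (M := A.toVCat)
    (fun α => (congrArg CatSp.Points.mk (Category.comp_id α.pt)).trans (CatSp.Points.mk_pt α))
    (fun α β => (InternalFunctor.Γmap_up _ (CatSp.Points.pt_mk _) (CatSp.Points.pt_mk _)).trans
      ((Category.comp_id _).trans (Category.id_comp _).symm))
  map_comp {A B C} F G := CatSp.enriched_ext (M := A.toVCat)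
    (fun α => congrArg CatSp.Points.mk ((Category.assoc _ _ _).symm.trans
      (congrArg (· ≫ G.onObj) (CatSp.Points.pt_mk (α.pt ≫ F.onObj)).symm)))
    (fun α β => by
      refine Eq.trans (b := A.up α.pt β.pt ≫ F.onArr ≫ G.onArr) ?_ (Eq.symm ?_)
      · exact InternalFunctor.Γmap_up _ (CatSp.Points.pt_mk _) (CatSp.Points.pt_mk _)
      · refine (Category.assoc _ _ _).trans ?_
        refine (congrArg (_ ≫ ·) (InternalFunctor.Γmap_up _ (CatSp.Points.pt_mk _)
          (CatSp.Points.pt_mk _))).trans ?_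
        exact InternalFunctor.Γmap_up_assoc _ (CatSp.Points.pt_mk _) (CatSp.Points.pt_mk _) _)

end En

/-! ## The internal category associated with an enriched category -/

section Int

variable {V : Type u} [Category.{v} V] [CartesianMonoidalCategory V] [HasFiniteLimits V]

namespace VCat

section

variable (M : VCat.{w} V)

/-- The object of arrows from `a` to `b`. -/
abbrev hom (a b : M.carrier) : V := a ⟶[V] b

variable {M} in
/-- The composite "`g` after `f`" of generalized arrows of an enriched category. -/
abbrev compose {T : V} {a b c : M.carrier} (g : T ⟶ M.hom b c) (f : T ⟶ M.hom a b) :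
    T ⟶ M.hom a c :=
  lift f g ≫ eComp V a b c

/-- The object of idempotents on `a`. -/
abbrev idem (a : M.carrier) : V :=
  equalizer (compose (𝟙 (M.hom a a)) (𝟙 (M.hom a a))) (𝟙 (M.hom a a))

/-- The inclusion of the idempotents on `a` into the arrows from `a` to `a`. -/
abbrev idemι (a : M.carrier) : M.idem a ⟶ M.hom a a :=
  equalizer.ι (compose (𝟙 (M.hom a a)) (𝟙 (M.hom a a))) (𝟙 (M.hom a a))

/-- The object of triples `(d, f, e)` with `e` an idempotent on `a`, `d` an idempotent on `b` and
`f` an arrow from `a` to `b`. -/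
abbrev triple (a b : M.carrier) : V := M.idem b ⊗ (M.hom a b ⊗ M.idem a)

/-- The first projection `(d, f, e) ↦ d`. -/
abbrev π₁ (a b : M.carrier) : M.triple a b ⟶ M.idem b := fst _ _

/-- The second projection `(d, f, e) ↦ f`. -/
abbrev π₂ (a b : M.carrier) : M.triple a b ⟶ M.hom a b := snd _ _ ≫ fst _ _

/-- The third projection `(d, f, e) ↦ e`. -/
abbrev π₃ (a b : M.carrier) : M.triple a b ⟶ M.idem a := snd _ _ ≫ snd _ _

/-- The arrow `(d, f, e) ↦ d f e`. -/
abbrev α (a b : M.carrier) : M.triple a b ⟶ M.hom a b :=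
  compose (M.π₁ a b ≫ M.idemι b) (compose (M.π₂ a b) (M.π₃ a b ≫ M.idemι a))

/-- The arrow `(d, f, e) ↦ (d, d f e, e)`. -/
abbrev αTriple (a b : M.carrier) : M.triple a b ⟶ M.triple a b :=
  lift (M.π₁ a b) (lift (M.α a b) (M.π₃ a b))

/-- The object of the triples `(d, f, e)` with `d f e = f`. -/
abbrev splitArr (a b : M.carrier) : V := equalizer (M.αTriple a b) (𝟙 (M.triple a b))

/-- The inclusion of the triples `(d, f, e)` with `d f e = f` into all triples. -/
abbrev splitArrι (a b : M.carrier) : M.splitArr a b ⟶ M.triple a b :=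
  equalizer.ι (M.αTriple a b) (𝟙 (M.triple a b))

end

section

variable [HasCoproducts.{w} V] (M : VCat.{w} V)

/-- The coproduct of all the objects of arrows. -/
abbrev homs : V := ∐ fun p : M.carrier × M.carrier => M.hom p.1 p.2

/-- The coproduct of all the objects of composable pairs: the component at `(a, b, c)` consists
of the pairs of an arrow from `b` to `c` and an arrow from `a` to `b`. -/
abbrev pairs : V :=
  ∐ fun p : M.carrier × M.carrier × M.carrier => M.hom p.2.1 p.2.2 ⊗ M.hom p.1 p.2.1

/-- The arrow induced by the first projections `(g, f) ↦ g`. -/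
abbrev pairsFst : M.pairs ⟶ M.homs :=
  Sigma.desc fun p : M.carrier × M.carrier × M.carrier =>
    fst _ _ ≫ Sigma.ι (fun q : M.carrier × M.carrier => M.hom q.1 q.2) (p.2.1, p.2.2)

/-- The arrow induced by the second projections `(g, f) ↦ f`. -/
abbrev pairsSnd : M.pairs ⟶ M.homs :=
  Sigma.desc fun p : M.carrier × M.carrier × M.carrier =>
    snd _ _ ≫ Sigma.ι (fun q : M.carrier × M.carrier => M.hom q.1 q.2) (p.1, p.2.1)

/-- The arrow induced by the compositions `(g, f) ↦ g f`. -/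
abbrev pairsComp : M.pairs ⟶ M.homs :=
  Sigma.desc fun p : M.carrier × M.carrier × M.carrier =>
    compose (fst _ _) (snd _ _) ≫
      Sigma.ι (fun q : M.carrier × M.carrier => M.hom q.1 q.2) (p.1, p.2.2)

/-- The coproduct of all the objects of triples. -/
abbrev triples : V := ∐ fun p : M.carrier × M.carrier => M.triple p.1 p.2

/-- The injection of a component. -/
abbrev triplesι (a b : M.carrier) : M.triple a b ⟶ M.triples :=
  Sigma.ι (fun p : M.carrier × M.carrier => M.triple p.1 p.2) (a, b)

/-- The arrow induced by the arrows `(d, f, e) ↦ (d, d f e, e)`. -/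
abbrev αTriples : M.triples ⟶ M.triples :=
  Limits.Sigma.map fun p : M.carrier × M.carrier => M.αTriple p.1 p.2

/-- `IntPresentation M A` consists of the data and equations that exhibit the internal category `A`, with
its splitting of idempotents, as the internal category constructed from `M`: the splitting
category ("Karoubi envelope") of `M`, formed inside `V`. -/
structure IntPresentation (A : CatSp.{w} V) where
  /-- the object of objects is the equalizer of the first projection, the composition and the
  second projection, that is, the object of idempotents of `M` -/
  ε : A.obj ⟶ M.pairs
  ε_fst : ε ≫ M.pairsFst = ε ≫ M.pairsComp
  ε_snd : ε ≫ M.pairsSnd = ε ≫ M.pairsComp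
  ε_universal : ∀ {T : V} (k : T ⟶ M.pairs), k ≫ M.pairsFst = k ≫ M.pairsComp →
    k ≫ M.pairsSnd = k ≫ M.pairsComp → ∃! l : T ⟶ A.obj, l ≫ ε = k
  /-- the object of arrows is the equalizer of `αTriples` and the identity, that is, the object
  of the triples `(d, f, e)` with `d` and `e` idempotents and `d f e = f` -/
  cα : A.arr ⟶ M.triples
  cα_condition : cα ≫ M.αTriples = cα ≫ 𝟙 M.triples
  cα_isLimit : Nonempty (IsLimit (Fork.ofι cα cα_condition))
  /-- the components of the object of objects, of which it is the coproduct -/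
  objι (a : M.carrier) : M.idem a ⟶ A.obj
  objι_ε (a : M.carrier) : objι a ≫ ε = lift (M.idemι a) (M.idemι a) ≫
    Sigma.ι (fun p : M.carrier × M.carrier × M.carrier =>
      M.hom p.2.1 p.2.2 ⊗ M.hom p.1 p.2.1) (a, a, a)
  objι_isColimit : Nonempty (IsColimit (Cofan.mk A.obj objι))
  /-- the components of the object of arrows, of which it is the coproduct -/
  arrι (a b : M.carrier) : M.splitArr a b ⟶ A.arr
  arrι_cα (a b : M.carrier) : arrι a b ≫ cα = M.splitArrι a b ≫ M.triplesι a b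
  arrι_isColimit : Nonempty (IsColimit (Cofan.mk
    (f := fun p : M.carrier × M.carrier => M.splitArr p.1 p.2) A.arr fun p => arrι p.1 p.2))
  /-- the domain of `(d, f, e)` is `e` -/
  dom_eq (a b : M.carrier) : arrι a b ≫ A.dom = M.splitArrι a b ≫ M.π₃ a b ≫ objι a
  /-- the codomain of `(d, f, e)` is `d` -/
  cod_eq (a b : M.carrier) : arrι a b ≫ A.cod = M.splitArrι a b ≫ M.π₁ a b ≫ objι b
  /-- the identity of `e` is `(e, e, e)` -/
  ident_eq (a : M.carrier) : (objι a ≫ A.ident) ≫ cα =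
    lift (𝟙 _) (lift (M.idemι a) (𝟙 _)) ≫ M.triplesι a a
  /-- the composite of `(k, g, d)` and `(d, f, e)` is `(k, g f, e)` -/
  comp_eq {T : V} (a b c : M.carrier) (g : T ⟶ M.splitArr b c) (f : T ⟶ M.splitArr a b)
    (_hgf : g ≫ M.splitArrι b c ≫ M.π₃ b c = f ≫ M.splitArrι a b ≫ M.π₁ a b)
    (h : (g ≫ arrι b c) ≫ A.dom = (f ≫ arrι a b) ≫ A.cod) :
    A.compose (g ≫ arrι b c) (f ≫ arrι a b) h ≫ cα =
      lift (g ≫ M.splitArrι b c ≫ M.π₁ b c)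
        (lift (compose (g ≫ M.splitArrι b c ≫ M.π₂ b c) (f ≫ M.splitArrι a b ≫ M.π₂ a b))
          (f ≫ M.splitArrι a b ≫ M.π₃ a b)) ≫ M.triplesι a c
  /-- an idempotent `(e, p, e)` splits with the section `(e, p, p)` -/
  S_eq {T : V} (a : M.carrier) (k : T ⟶ A.idem) (f : T ⟶ M.splitArr a a) (p : T ⟶ M.idem a)
    (_hk : k ≫ A.idemι = f ≫ arrι a a)
    (_hp : p ≫ M.idemι a = f ≫ M.splitArrι a a ≫ M.π₂ a a) :
    (k ≫ A.splitting.S) ≫ cα =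
      lift (f ≫ M.splitArrι a a ≫ M.π₁ a a) (lift (p ≫ M.idemι a) p) ≫ M.triplesι a a
  /-- an idempotent `(e, p, e)` splits with the retraction `(p, p, e)` -/
  R_eq {T : V} (a : M.carrier) (k : T ⟶ A.idem) (f : T ⟶ M.splitArr a a) (p : T ⟶ M.idem a)
    (_hk : k ≫ A.idemι = f ≫ arrι a a)
    (_hp : p ≫ M.idemι a = f ≫ M.splitArrι a a ≫ M.π₂ a a) :
    (k ≫ A.splitting.R) ≫ cα =
      lift p (lift (p ≫ M.idemι a) (f ≫ M.splitArrι a a ≫ M.π₃ a a)) ≫ M.triplesι a a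

end

/-- The action of an enriched functor on idempotents. -/
def idemMap {M N : VCat.{w} V} (F : M ⟶ N) (a : M.carrier) : M.idem a ⟶ N.idem (F.obj a) :=
  equalizer.lift (M.idemι a ≫ F.map a a) (by
    have h := equalizer.condition (compose (𝟙 (M.hom a a)) (𝟙 (M.hom a a))) (𝟙 (M.hom a a))
    have h' := congrArg (· ≫ F.map a a) h
    simp only [Category.assoc, Category.comp_id, EnrichedFunctor.map_comp, lift_map_assoc,
      Category.id_comp] at h'
    refine Eq.trans ?_ (h'.trans (Category.comp_id _).symm)
    simp only [comp_lift_assoc, Category.comp_id])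

/-- The action of an enriched functor on triples. -/
def tripleMap {M N : VCat.{w} V} (F : M ⟶ N) (a b : M.carrier) :
    M.triple a b ⟶ N.triple (F.obj a) (F.obj b) :=
  idemMap F b ⊗ₘ (F.map a b ⊗ₘ idemMap F a)

/-- The internal functor `G` between the internal categories constructed from `M` and `N` is the
one constructed from the enriched functor `F`: it sends an idempotent `e` to `F e` and a triple
`(d, f, e)` to `(F d, F f, F e)`. -/
structure IsIntMap [HasCoproducts.{w} V] {M N : VCat.{w} V} {A B : CatSp.{w} V}
    (P : IntPresentation M A) (Q : IntPresentation N B) (F : M ⟶ N) (G : A ⟶ B) : Prop where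
  onObj_eq (a : M.carrier) : P.objι a ≫ G.onObj = idemMap F a ≫ Q.objι (F.obj a)
  onArr_eq (a b : M.carrier) : (P.arrι a b ≫ G.onArr) ≫ Q.cα =
    (M.splitArrι a b ≫ tripleMap F a b) ≫ N.triplesι (F.obj a) (F.obj b)

end VCat

end Int

end IntEn

end

/-! Int(M) is the Karoubi envelope of M formed inside V, and the adjunction is the universal
property of that envelope in strict form. Let F be an enriched functor from M to the enriched
category of points of `A`, and write r, s for the chosen retractions and sections of `A`. Its
extension sends an idempotent e to the object through which F e splits, and a triple (d, f, e) to
r_{Fd} (F f) s_{Fe}. The unit sends f to (1, f, 1).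

Uniqueness: every triple factors as (d, f, e) = (d, d, 1)(1, f, 1)(1, e, e)
(`eq_compSplit_unitSplit`). The outer factors are the chosen retraction of (1, d, 1) and the chosen
section of (1, e, 1). A functor preserving splittings is therefore determined by its values on the
triples (1, f, 1) (`int_hom_ext`).

Existence: composites are preserved because s_{Fd} r_{Fd} = F d is absorbed by its neighbour
(`extEl_comp_extEl`). The idempotent (e, p, e) satisfies e p e = p and goes to r_{Fe} (F p) s_{Fe}.
Canonicity says that this idempotent splits through r_{Fp} s_{Fe} and r_{Fe} s_{Fp}, which are the
images of (p, p, e) and (e, p, p), so the splittings are preserved (`ext`). Since identities split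
through themselves, the extension restricts along the unit to F itself and not merely to an
isomorphic copy (`unit_comp_ext`).

The objects of objects and of arrows of Int(M) are coproducts, and a generalized element of a
coproduct need not lie in a single summand. By extensivity it does so after its domain is decomposed
as a coproduct (`IsCover.loc`), and two representatives of the same element agree after a further
decomposition (`loc_of_comp_sigmaι_eq`). Equations may be checked locally (`Loc.eq`) and compatible
local definitions glue (`exists_glue`). Hence composition, splittings and universal properties can
all be handled by formulas on the components. -/

noncomputable section

namespace IntEn

/-! ## Covers by coproduct injections -/

section Covers

variable {V : Type u} [Category.{v} V]

/-- A family of arrows exhibits its common codomain as the coproduct of the domains. -/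
structure IsCover {I : Type w} {X : I → V} {T : V} (t : ∀ i, X i ⟶ T) : Prop where
  hom_ext : ∀ {Z : V} {f g : T ⟶ Z}, (∀ i, t i ≫ f = t i ≫ g) → f = g
  exists_desc : ∀ {Z : V} (z : ∀ i, X i ⟶ Z), ∃ l : T ⟶ Z, ∀ i, t i ≫ l = z i

/-- A property of arrows into `T` holds locally if it holds for all arrows factoring through the
members of some decomposition of `T` as a coproduct. -/
def Loc {T : V} (P : ∀ ⦃S : V⦄, (S ⟶ T) → Prop) : Prop :=
  ∃ (I : Type w) (X : I → V) (t : ∀ i, X i ⟶ T), IsCover t ∧ ∀ i S (u : S ⟶ X i), P (u ≫ t i)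

/-- The members of the decomposition are jointly epimorphic, and each of them satisfies `P`, as the
case `u = 𝟙` of `Loc` shows. -/
lemma Loc.eq {T Z : V} {P : ∀ ⦃S : V⦄, (S ⟶ T) → Prop} (h : Loc.{w} P) {f g : T ⟶ Z}
    (hP : ∀ ⦃S : V⦄ (s : S ⟶ T), P s → s ≫ f = s ≫ g) : f = g := by
  obtain ⟨I, X, t, ht, hX⟩ := h
  exact ht.hom_ext fun i => hP _ (by simpa using hX i _ (𝟙 _))

/-- Locality is transitive: decomposing every member of a decomposition gives a decomposition
indexed by a sigma type, which is still `w`-small. -/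
lemma Loc.bind {T : V} {P Q : ∀ ⦃S : V⦄, (S ⟶ T) → Prop} (h : Loc.{w} P)
    (hPQ : ∀ ⦃S : V⦄ (s : S ⟶ T), P s → Loc.{w} fun _ r => Q (r ≫ s)) : Loc.{w} Q := by
  obtain ⟨I, X, t, ht, hX⟩ := h
  choose J Y y hy hQ using fun i => hPQ (t i) (by simpa using hX i _ (𝟙 _))
  refine ⟨Σ i, J i, fun p => Y p.1 p.2, fun p => y p.1 p.2 ≫ t p.1, ⟨fun h => ?_, fun z => ?_⟩,
    fun p S u => by simpa using hQ p.1 p.2 S u⟩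
  · exact ht.hom_ext fun i => (hy i).hom_ext fun j => by simpa using h ⟨i, j⟩
  · choose l hl using fun i => (hy i).exists_desc fun j => z ⟨i, j⟩
    obtain ⟨k, hk⟩ := ht.exists_desc l
    exact ⟨k, fun p => by simp [hk, hl]⟩

lemma Loc.mono {T : V} {P Q : ∀ ⦃S : V⦄, (S ⟶ T) → Prop} (h : Loc.{w} P)
    (hPQ : ∀ ⦃S : V⦄ (s : S ⟶ T), P s → Q s) : Loc.{w} Q := by
  obtain ⟨I, X, t, ht, hX⟩ := h
  exact ⟨I, X, t, ht, fun i S u => hPQ _ (hX i S u)⟩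

/-! ### Generalized elements of coproducts in an extensive category -/

section

variable [HasCoproducts.{w} V]

lemma isCover_sigmaι {I : Type w} (X : I → V) : IsCover (Sigma.ι X) :=
  ⟨fun h => Sigma.hom_ext _ _ h, fun z => ⟨Sigma.desc z, by simp⟩⟩

variable [Extensive.{w} V]

/-- Essential surjectivity of the coproduct functor on slices. -/
lemma exists_iso_sigma {I : Type w} {X : I → V} {T : V} (f : T ⟶ ∐ X) :
    ∃ (Y : I → V) (y : ∀ i, Y i ⟶ X i) (e : ∐ Y ≅ T), e.hom ≫ f = Limits.Sigma.map y := by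
  have := Extensive.isEquivalence (V := V) I X
  exact ⟨fun i => ((coprodOver X).objPreimage (Over.mk f) i).left,
    fun i => ((coprodOver X).objPreimage (Over.mk f) i).hom, (Over.forget _).mapIso ((coprodOver X).objObjPreimageIso (Over.mk f)),
    Over.w ((coprodOver X).objObjPreimageIso (Over.mk f)).hom⟩

/-- Fullness of the coproduct functor on slices. -/
lemma exists_eq_sigma_map {I : Type w} {X Y Z : I → V} (y : ∀ i, Y i ⟶ X i) (z : ∀ i, Z i ⟶ X i)
    (Φ : ∐ Y ⟶ ∐ Z) (h : Φ ≫ Limits.Sigma.map z = Limits.Sigma.map y) :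
    ∃ φ : ∀ i, Y i ⟶ Z i, (∀ i, φ i ≫ z i = y i) ∧ Limits.Sigma.map φ = Φ := by
  have := Extensive.isEquivalence (V := V) I X
  obtain ⟨φ, hφ⟩ := (coprodOver X).map_surjective (X := fun i => Over.mk (y i))
    (Y := fun i => Over.mk (z i)) (Over.homMk Φ h)
  exact ⟨fun i => (φ i).left, fun i => Over.w (φ i), congrArg CommaMorphism.left hφ⟩

lemma exists_isCover {I : Type w} {X : I → V} {T : V} (f : T ⟶ ∐ X) :
    ∃ (Y : I → V) (t : ∀ i, Y i ⟶ T) (y : ∀ i, Y i ⟶ X i),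
      IsCover t ∧ ∀ i, t i ≫ f = y i ≫ Sigma.ι X i := by
  obtain ⟨Y, y, e, he⟩ := exists_iso_sigma f
  refine ⟨Y, fun i => Sigma.ι Y i ≫ e.hom, y, ⟨fun {Z a b} h => ?_, fun z =>
    ⟨e.inv ≫ Sigma.desc z, fun i => by simp⟩⟩, fun i => by simp [he]⟩
  rw [← cancel_epi e.hom]
  exact Sigma.hom_ext _ _ fun i => by simpa using h i

/-- The arrow `ψ` is a section of `Sigma.desc t`, so a decomposition of `S` adapted to `f ≫ ψ`,
which lands in an actual coproduct, is also adapted to `f`. -/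
lemma IsCover.loc {I : Type w} {X : I → V} {T S : V} {t : ∀ i, X i ⟶ T} (ht : IsCover t)
    (f : S ⟶ T) : Loc.{w} fun _ s => ∃ i y, s ≫ f = y ≫ t i := by
  obtain ⟨ψ, hψ⟩ := ht.exists_desc (Sigma.ι X)
  have h : ψ ≫ Sigma.desc t = 𝟙 T := ht.hom_ext fun i => by simp [reassoc_of% hψ]
  obtain ⟨Y, s, y, hs, hy⟩ := exists_isCover (f ≫ ψ)
  refine ⟨I, Y, s, hs, fun i S u => ⟨i, u ≫ y i, ?_⟩⟩
  have := congrArg (· ≫ Sigma.desc t) (hy i)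
  simp only [Category.assoc, h, colimit.ι_desc, Cofan.mk_ι_app, Category.comp_id] at this
  simp [this]

/-- Coproduct injections are disjoint monomorphisms. -/
lemma loc_of_comp_sigmaι_eq {I : Type w} {X : I → V} {T : V} {i j : I} (f : T ⟶ X i)
    (g : T ⟶ X j) (h : f ≫ Sigma.ι X i = g ≫ Sigma.ι X j) :
    Loc.{w} fun S s => (⟨i, s ≫ f⟩ : Σ k, S ⟶ X k) = ⟨j, s ≫ g⟩ := by
  -- The family `δ i` is `T` at the index `i` and an empty coproduct elsewhere. Indexing by proofs
  -- of `i = k` avoids a case distinction, and the subtype of `PUnit` puts these proofs in `Type w`.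
  -- Thus `∐ δ i` and `∐ δ j` are two copies of `T`, lying over `∐ X` through `f` and `g`.
  let J : I → I → Type w := fun i k => {_u : PUnit.{w + 1} // i = k}
  let δ : I → I → V := fun i k => ∐ fun _ : J i k => T
  let p : ∀ (i : I) (_ : T ⟶ X i) (k : I), δ i k ⟶ X k := fun i f k =>
    Sigma.desc fun h : J i k => f ≫ eqToHom (congrArg X h.2)
  let inc : ∀ i, T ⟶ δ i i := fun i => Sigma.ι (fun _ : J i i => T) ⟨⟨⟩, rfl⟩
  let fold : ∀ k, δ j k ⟶ T := fun k => Sigma.desc fun _ : J j k => 𝟙 T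
  have hp : ∀ i f, inc i ≫ p i f i = f := fun i f => by simp [inc, p]
  have hfold : inc j ≫ fold j = 𝟙 T := by simp [inc, fold]
  -- `Φ` is the identity of `T` seen between the two copies. It is an arrow over `∐ X` by `h`, so it
  -- has components; the one at `i` goes from a copy of `T` to `δ j i`.
  let Φ : ∐ δ i ⟶ ∐ δ j :=
    Sigma.desc fun k => Sigma.desc fun _ : J i k => inc j ≫ Sigma.ι (δ j) j
  have hΦ : inc i ≫ Sigma.ι (δ i) i ≫ Φ = inc j ≫ Sigma.ι (δ j) j := by simp [Φ, inc]
  obtain ⟨φ, hφ, hφ'⟩ := exists_eq_sigma_map (p i f) (p j g) Φ (by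
    refine Sigma.hom_ext _ _ fun k => Sigma.hom_ext _ _ fun ⟨_, hk⟩ => ?_
    subst hk
    change inc i ≫ Sigma.ι (δ i) i ≫ Φ ≫ _ = inc i ≫ Sigma.ι (δ i) i ≫ _
    rw [reassoc_of% hΦ]
    simp [reassoc_of% hp, h])
  let θ : T ⟶ δ j i := inc i ≫ φ i
  have hθ : θ ≫ p j g i = f := by rw [Category.assoc, hφ, hp]
  have hθ' : θ ≫ fold i = 𝟙 T := by
    have := hΦ =≫ Sigma.desc fold
    rw [← hφ'] at this
    simpa [hfold, θ] using this
  -- Locally `θ` factors through a summand of `δ j i`, and the index of that summand is a proof of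
  -- `j = i`. For distinct indices there is no summand and the decomposition is empty.
  refine ((isCover_sigmaι _).loc θ).mono fun S s ⟨⟨_, h'⟩, y, hy⟩ => ?_
  subst h'
  have h₁ : s = y := by
    have := hy =≫ fold j
    simpa only [Category.assoc, hθ', hfold, Category.comp_id, inc] using this
  have h₂ : s ≫ f = y ≫ g := by
    have := hy =≫ p j g j
    rw [Category.assoc, hθ, Category.assoc] at this
    rw [this]
    exact congrArg (y ≫ ·) (hp j g)
  rw [h₂, h₁]

/-- Gluing of a locally defined arrow. -/
lemma exists_glue {T Z : V} (R : ∀ ⦃S : V⦄, (S ⟶ T) → (S ⟶ Z) → Prop)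
    (stable : ∀ ⦃S S' : V⦄ (r : S' ⟶ S) (s : S ⟶ T) (z : S ⟶ Z), R s z → R (r ≫ s) (r ≫ z))
    (functional : ∀ ⦃S : V⦄ (s : S ⟶ T) (z z' : S ⟶ Z), R s z → R s z' → z = z')
    (total : Loc.{w} fun _ s => ∃ z, R s z) :
    ∃ z : T ⟶ Z, ∀ ⦃S : V⦄ (s : S ⟶ T) (y : S ⟶ Z), R s y → s ≫ z = y := by
  obtain ⟨I, X, t, ht, hX⟩ := total
  choose z hz using fun i => (by simpa using hX i _ (𝟙 _) : ∃ z, R (t i) z)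
  obtain ⟨l, hl⟩ := ht.exists_desc z
  -- The value `y` need not come from a chosen `z i`; the two are compared on a decomposition of `S`
  -- whose members factor through the `X i`.
  refine ⟨l, fun S s y hy => (ht.loc s).eq fun S' r ⟨i, x, hx⟩ => ?_⟩
  refine functional (r ≫ s) _ _ ?_ (stable _ _ _ hy)
  rw [← Category.assoc, hx, Category.assoc, hl]
  exact stable _ _ _ (hz i)

end

end Covers

/-- Stability of composition under precomposition needs no axioms. It is stated for bare data so as
to be available while the axioms of `intCat` are being verified. -/
lemma InternalCategoryData.precomp_compose {V : Type u} [Category.{v} V] [HasPullbacks V]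
    (A : InternalCategoryData V) {T T' : V} (k : T' ⟶ T) (g f : T ⟶ A.arr)
    (h : g ≫ A.dom = f ≫ A.cod) :
    k ≫ A.compose g f h = A.compose (k ≫ g) (k ≫ f) (by simp [h]) := by
  simp only [InternalCategoryData.compose, ← Category.assoc]
  congr 1
  ext <;> simp [pullback.lift_fst, pullback.lift_snd]

namespace VCat

/-! ## Generalized arrows of an enriched category -/

section Elements

variable {V : Type u} [Category.{v} V] [CartesianMonoidalCategory V] {M : VCat.{w} V} {T S : V}

/-- Composition of generalized arrows, opaque to the simplifier. -/
def cmp {a b c : M.carrier} (g : T ⟶ a ⟶[V] b) (f : T ⟶ c ⟶[V] a) : T ⟶ c ⟶[V] b :=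
  lift f g ≫ eComp V c a b

local infixr:80 " ⊙ " => VCat.cmp

/-- The generalized identity arrow. -/
def one (T : V) (a : M.carrier) : T ⟶ a ⟶[V] a := toUnit T ≫ eId V a

variable {a b c d : M.carrier}

@[simp]
lemma comp_cmp (s : S ⟶ T) (g : T ⟶ b ⟶[V] c) (f : T ⟶ a ⟶[V] b) :
    s ≫ (g ⊙ f) = (s ≫ g) ⊙ (s ≫ f) := by
  simp [cmp, comp_lift_assoc]

@[simp]
lemma comp_one (s : S ⟶ T) : s ≫ one T a = one S a := by
  rw [one, one, ← Category.assoc, comp_toUnit]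

-- The associativity axiom of the enrichment, evaluated at the generalized element (f, (g, k)). The
-- arguments of `eComp` are in diagrammatic order, those of `⊙` are not.
@[simp]
lemma cmp_assoc (k : T ⟶ c ⟶[V] d) (g : T ⟶ b ⟶[V] c) (f : T ⟶ a ⟶[V] b) :
    (k ⊙ g) ⊙ f = k ⊙ g ⊙ f := by
  have h := lift f (lift g k) ≫= e_assoc V a b c d
  have h₁ : lift f (lift g k) ≫ (α_ _ _ _).inv ≫ eComp V a b c ▷ _ = lift (g ⊙ f) k := by
    ext <;> simp [cmp]
  have h₂ : lift f (lift g k) ≫ _ ◁ eComp V b c d = lift f (k ⊙ g) := by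
    ext <;> simp [cmp]
  rw [reassoc_of% h₁, reassoc_of% h₂] at h
  exact h.symm

@[simp]
lemma one_cmp (f : T ⟶ a ⟶[V] b) : one T b ⊙ f = f := by
  have h := f ≫= e_comp_id V a b
  have h₁ : f ≫ (ρ_ _).inv ≫ _ ◁ eId V b = lift f (one T b) := by
    ext
    · simp
    · simp [one]
  rw [reassoc_of% h₁, Category.comp_id] at h
  exact h

@[simp]
lemma cmp_one (f : T ⟶ a ⟶[V] b) : f ⊙ one T a = f := by
  have h := f ≫= e_id_comp V a b
  have h₁ : f ≫ (λ_ _).inv ≫ eId V a ▷ _ = lift (one T a) f := by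
    ext
    · simp [one]
    · simp
  rw [reassoc_of% h₁, Category.comp_id] at h
  exact h

/-- Composites are normalized to nest to the right, which hides `k ⊙ g` inside `k ⊙ g ⊙ f`; this is
the reassociated form of an equation for `k ⊙ g`. -/
lemma cmp_cmp_of_eq {d' : M.carrier} {k : T ⟶ c ⟶[V] d} {g : T ⟶ b ⟶[V] c} {l : T ⟶ b ⟶[V] d}
    (h : k ⊙ g = l) (f : T ⟶ d' ⟶[V] b) : k ⊙ g ⊙ f = l ⊙ f := by
  rw [← cmp_assoc, h]

@[simp]
lemma cmp_comp_map {N : VCat.{w} V} (F : EnrichedFunctor V M.carrier N.carrier)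
    (g : T ⟶ b ⟶[V] c) (f : T ⟶ a ⟶[V] b) :
    (g ⊙ f) ≫ F.map a c = (g ≫ F.map b c) ⊙ (f ≫ F.map a b) := by
  simp [cmp]

@[simp]
lemma one_comp_map {N : VCat.{w} V} (F : EnrichedFunctor V M.carrier N.carrier) :
    one T a ≫ F.map a a = one T (F.obj a) := by
  simp [one]

lemma eComp_eq_cmp (a b c : M.carrier) :
    eComp V a b c = snd (a ⟶[V] b) (b ⟶[V] c) ⊙ fst (a ⟶[V] b) (b ⟶[V] c) := by
  simp [cmp]

lemma eId_eq_one (a : M.carrier) : eId V a = one (𝟙_ V) a := by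
  rw [one, toUnit_unique (toUnit (𝟙_ V)) (𝟙 _), Category.id_comp]

variable [HasFiniteLimits V]

/-- A generalized idempotent arrow is a generalized element of the object of idempotents. -/
def mkIdem (p : T ⟶ a ⟶[V] a) (hp : p ⊙ p = p) : T ⟶ M.idem a :=
  equalizer.lift p (by simpa [cmp, compose, comp_lift_assoc] using hp)

@[simp]
lemma mkIdem_ι (p : T ⟶ a ⟶[V] a) (hp : p ⊙ p = p) : mkIdem p hp ≫ M.idemι a = p :=
  equalizer.lift_ι _ _

lemma idem_ext {e e' : T ⟶ M.idem a} (h : e ≫ M.idemι a = e' ≫ M.idemι a) : e = e' :=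
  equalizer.hom_ext h

@[simp]
lemma idem_cmp_idem (e : T ⟶ M.idem a) : (e ≫ M.idemι a) ⊙ (e ≫ M.idemι a) = e ≫ M.idemι a := by
  have h := e ≫= equalizer.condition (compose (𝟙 (M.hom a a)) (𝟙 (M.hom a a))) (𝟙 (M.hom a a))
  simpa [cmp, compose, comp_lift_assoc] using h

@[simp]
lemma idem_cmp_idem_cmp (e : T ⟶ M.idem a) (f : T ⟶ b ⟶[V] a) :
    (e ≫ M.idemι a) ⊙ (e ≫ M.idemι a) ⊙ f = (e ≫ M.idemι a) ⊙ f :=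
  cmp_cmp_of_eq (idem_cmp_idem e) f

/-- The generalized identity arrow as an idempotent. -/
def oneIdem (T : V) (a : M.carrier) : T ⟶ M.idem a := mkIdem (one T a) (by simp)

@[simp]
lemma oneIdem_ι : oneIdem T a ≫ M.idemι a = one T a := mkIdem_ι _ _

@[simp]
lemma comp_oneIdem (s : S ⟶ T) : s ≫ oneIdem T a = oneIdem S a := idem_ext (by simp)

/-- The component `e` of a generalized triple `(d, f, e)`. -/
def src (x : T ⟶ M.splitArr a b) : T ⟶ M.idem a := x ≫ M.splitArrι a b ≫ M.π₃ a b

/-- The component `f` of a generalized triple `(d, f, e)`. -/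
def mid (x : T ⟶ M.splitArr a b) : T ⟶ a ⟶[V] b := x ≫ M.splitArrι a b ≫ M.π₂ a b

/-- The component `d` of a generalized triple `(d, f, e)`. -/
def tgt (x : T ⟶ M.splitArr a b) : T ⟶ M.idem b := x ≫ M.splitArrι a b ≫ M.π₁ a b

@[simp]
lemma src_comp (s : S ⟶ T) (x : T ⟶ M.splitArr a b) : src (s ≫ x) = s ≫ src x :=
  Category.assoc _ _ _

@[simp]
lemma mid_comp (s : S ⟶ T) (x : T ⟶ M.splitArr a b) : mid (s ≫ x) = s ≫ mid x :=
  Category.assoc _ _ _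

@[simp]
lemma tgt_comp (s : S ⟶ T) (x : T ⟶ M.splitArr a b) : tgt (s ≫ x) = s ≫ tgt x :=
  Category.assoc _ _ _

lemma comp_splitArrι (x : T ⟶ M.splitArr a b) :
    x ≫ M.splitArrι a b = lift (tgt x) (lift (mid x) (src x)) := by
  ext <;> simp [tgt, mid, src]

lemma comp_α (x : T ⟶ M.triple a b) :
    x ≫ M.α a b = (x ≫ M.π₁ a b ≫ M.idemι b) ⊙ (x ≫ M.π₂ a b) ⊙ (x ≫ M.π₃ a b ≫ M.idemι a) := by
  simp [cmp, compose, comp_lift_assoc]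

lemma split_ext {x y : T ⟶ M.splitArr a b} (hd : tgt x = tgt y) (hf : mid x = mid y)
    (he : src x = src y) : x = y := by
  apply equalizer.hom_ext
  change x ≫ M.splitArrι a b = y ≫ M.splitArrι a b
  rw [comp_splitArrι, comp_splitArrι, hd, hf, he]

/-- The generalized triple `(d, f, e)`. -/
def mkSplit (d : T ⟶ M.idem b) (f : T ⟶ a ⟶[V] b) (e : T ⟶ M.idem a)
    (hd : (d ≫ M.idemι b) ⊙ f = f) (he : f ⊙ (e ≫ M.idemι a) = f) : T ⟶ M.splitArr a b :=
  equalizer.lift (lift d (lift f e)) (by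
    have : lift d (lift f e) ≫ M.α a b = f := by
      rw [comp_α]
      simp [hd, he]
    rw [comp_lift, comp_lift, this]
    simp)

lemma mkSplit_splitArrι (d : T ⟶ M.idem b) (f : T ⟶ a ⟶[V] b) (e : T ⟶ M.idem a)
    (hd : (d ≫ M.idemι b) ⊙ f = f) (he : f ⊙ (e ≫ M.idemι a) = f) :
    mkSplit d f e hd he ≫ M.splitArrι a b = lift d (lift f e) :=
  equalizer.lift_ι _ _

section

variable (d : T ⟶ M.idem b) (f : T ⟶ a ⟶[V] b) (e : T ⟶ M.idem a)
    (hd : (d ≫ M.idemι b) ⊙ f = f) (he : f ⊙ (e ≫ M.idemι a) = f)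

@[simp]
lemma src_mkSplit : src (mkSplit d f e hd he) = e := by
  rw [src, ← Category.assoc, mkSplit_splitArrι]
  simp

@[simp]
lemma mid_mkSplit : mid (mkSplit d f e hd he) = f := by
  rw [mid, ← Category.assoc, mkSplit_splitArrι]
  simp

@[simp]
lemma tgt_mkSplit : tgt (mkSplit d f e hd he) = d := by
  rw [tgt, ← Category.assoc, mkSplit_splitArrι]
  simp

end

/-- The middle component of the equation defining `splitArr`. Idempotency of d and e splits it into
d f = f and f e = f, the form in which `mkSplit` and the later computations use it. -/
lemma tgt_cmp_mid_cmp_src (x : T ⟶ M.splitArr a b) :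
    (tgt x ≫ M.idemι b) ⊙ mid x ⊙ (src x ≫ M.idemι a) = mid x := by
  have h := x ≫= equalizer.condition (M.αTriple a b) (𝟙 (M.triple a b)) =≫ M.π₂ a b
  have h' := comp_α (x ≫ M.splitArrι a b)
  simp only [Category.assoc, αTriple, lift_snd_assoc, lift_fst, Category.comp_id] at h h'
  simp only [tgt, mid, src, Category.assoc]
  rw [← h', ← h]

@[simp]
lemma tgt_cmp_mid (x : T ⟶ M.splitArr a b) : (tgt x ≫ M.idemι b) ⊙ mid x = mid x := by
  rw [← tgt_cmp_mid_cmp_src x, idem_cmp_idem_cmp]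

@[simp]
lemma mid_cmp_src (x : T ⟶ M.splitArr a b) : mid x ⊙ (src x ≫ M.idemι a) = mid x := by
  rw [← tgt_cmp_mid_cmp_src x]
  simp

@[simp]
lemma tgt_cmp_mid_cmp (x : T ⟶ M.splitArr a b) (f : T ⟶ c ⟶[V] a) :
    (tgt x ≫ M.idemι b) ⊙ mid x ⊙ f = mid x ⊙ f :=
  cmp_cmp_of_eq (tgt_cmp_mid x) f

/-- The composite `(k, g f, e)` of `(k, g, d)` and `(d', f, e)`. -/
def compSplit (g : T ⟶ M.splitArr b c) (f : T ⟶ M.splitArr a b) : T ⟶ M.splitArr a c :=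
  mkSplit (tgt g) (mid g ⊙ mid f) (src f) (by simp) (by simp)

@[simp]
lemma src_compSplit (g : T ⟶ M.splitArr b c) (f : T ⟶ M.splitArr a b) :
    src (compSplit g f) = src f := src_mkSplit ..

@[simp]
lemma mid_compSplit (g : T ⟶ M.splitArr b c) (f : T ⟶ M.splitArr a b) :
    mid (compSplit g f) = mid g ⊙ mid f := mid_mkSplit ..

@[simp]
lemma tgt_compSplit (g : T ⟶ M.splitArr b c) (f : T ⟶ M.splitArr a b) :
    tgt (compSplit g f) = tgt g := tgt_mkSplit ..

lemma comp_compSplit (s : S ⟶ T) (g : T ⟶ M.splitArr b c) (f : T ⟶ M.splitArr a b) :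
    s ≫ compSplit g f = compSplit (s ≫ g) (s ≫ f) := by
  apply split_ext <;> simp only [src_comp, src_compSplit, mid_comp, mid_compSplit, tgt_comp,
    tgt_compSplit, comp_cmp]

/-- The identity `(e, e, e)` of an idempotent. -/
def idSplit (e : T ⟶ M.idem a) : T ⟶ M.splitArr a a :=
  mkSplit e (e ≫ M.idemι a) e (by simp) (by simp)

@[simp]
lemma src_idSplit (e : T ⟶ M.idem a) : src (idSplit e) = e := src_mkSplit ..

@[simp]
lemma mid_idSplit (e : T ⟶ M.idem a) : mid (idSplit e) = e ≫ M.idemι a := mid_mkSplit ..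

@[simp]
lemma tgt_idSplit (e : T ⟶ M.idem a) : tgt (idSplit e) = e := tgt_mkSplit ..

lemma comp_idSplit (s : S ⟶ T) (e : T ⟶ M.idem a) : s ≫ idSplit e = idSplit (s ≫ e) := by
  apply split_ext <;> simp

lemma idSplit_compSplit (f : T ⟶ M.splitArr a b) : compSplit (idSplit (tgt f)) f = f := by
  apply split_ext <;> simp

lemma compSplit_idSplit (f : T ⟶ M.splitArr a b) : compSplit f (idSplit (src f)) = f := by
  apply split_ext <;> simp

lemma compSplit_assoc (k : T ⟶ M.splitArr c d) (g : T ⟶ M.splitArr b c)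
    (f : T ⟶ M.splitArr a b) :
    compSplit (compSplit k g) f = compSplit k (compSplit g f) := by
  apply split_ext <;> simp

end Elements

/-! ## The internal category of idempotents of an enriched category -/

section IntData

variable {V : Type u} [Category.{v} V] [CartesianMonoidalCategory V] [HasFiniteLimits V]
  [HasCoproducts.{w} V] {M : VCat.{w} V} {T S : V} {a b c d : M.carrier}

variable (M) in
/-- The object of all idempotents. -/
def intObj : V := ∐ fun a : M.carrier => M.idem a

/-- The idempotents on `a` among all the idempotents. -/
def objι (a : M.carrier) : M.idem a ⟶ M.intObj := Sigma.ι (fun a : M.carrier => M.idem a) a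

variable (M) in
/-- The object of all triples `(d, f, e)` with `d f e = f`. -/
def intArr : V := ∐ fun p : M.carrier × M.carrier => M.splitArr p.1 p.2

/-- The triples from `a` to `b` among all the triples. -/
def arrι (a b : M.carrier) : M.splitArr a b ⟶ M.intArr :=
  Sigma.ι (fun p : M.carrier × M.carrier => M.splitArr p.1 p.2) (a, b)

/-- The arrow out of the object of idempotents given by its components. -/
def objDesc {Z : V} (k : ∀ a, M.idem a ⟶ Z) : M.intObj ⟶ Z := Sigma.desc k

@[simp]
lemma objι_desc {Z : V} (k : ∀ a, M.idem a ⟶ Z) (a : M.carrier) : objι a ≫ objDesc k = k a :=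
  Sigma.ι_desc _ _

/-- The arrow out of the object of triples given by its components. -/
def arrDesc {Z : V} (k : ∀ a b, M.splitArr a b ⟶ Z) : M.intArr ⟶ Z :=
  Sigma.desc fun p => k p.1 p.2

@[simp]
lemma arrι_desc {Z : V} (k : ∀ a b, M.splitArr a b ⟶ Z) (a b : M.carrier) :
    arrι a b ≫ arrDesc k = k a b :=
  Sigma.ι_desc (fun p : M.carrier × M.carrier => k p.1 p.2) (a, b)

lemma intObj_ext {Z : V} {f g : M.intObj ⟶ Z} (h : ∀ a, objι a ≫ f = objι a ≫ g) : f = g :=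
  Sigma.hom_ext _ _ h

lemma intArr_ext {Z : V} {f g : M.intArr ⟶ Z} (h : ∀ a b, arrι a b ≫ f = arrι a b ≫ g) : f = g :=
  Sigma.hom_ext _ _ fun p => h p.1 p.2

section

variable [Extensive.{w} V]

lemma loc_obj (e : T ⟶ M.intObj) :
    Loc.{w} fun S s => ∃ a, ∃ e' : S ⟶ M.idem a, s ≫ e = e' ≫ objι a :=
  (isCover_sigmaι _).loc e

lemma loc_arr (f : T ⟶ M.intArr) :
    Loc.{w} fun S s => ∃ a b, ∃ f' : S ⟶ M.splitArr a b, s ≫ f = f' ≫ arrι a b :=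
  ((isCover_sigmaι _).loc f).mono fun _ _ ⟨p, y, h⟩ => ⟨p.1, p.2, y, h⟩

lemma loc_of_comp_objι_eq (e : T ⟶ M.idem a) (e' : T ⟶ M.idem b)
    (h : e ≫ objι a = e' ≫ objι b) :
    Loc.{w} fun S s => (⟨a, s ≫ e⟩ : Σ c, S ⟶ M.idem c) = ⟨b, s ≫ e'⟩ :=
  loc_of_comp_sigmaι_eq e e' h

lemma loc_of_comp_arrι_eq {a' b' : M.carrier} (f : T ⟶ M.splitArr a b)
    (f' : T ⟶ M.splitArr a' b') (h : f ≫ arrι a b = f' ≫ arrι a' b') :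
    Loc.{w} fun S s => (⟨(a, b), s ≫ f⟩ : Σ p : M.carrier × M.carrier, S ⟶ M.splitArr p.1 p.2) =
      ⟨(a', b'), s ≫ f'⟩ :=
  loc_of_comp_sigmaι_eq (X := fun p : M.carrier × M.carrier => M.splitArr p.1 p.2) (i := (a, b))
    (j := (a', b')) f f' h

lemma objι_cancel {e e' : T ⟶ M.idem a} (h : e ≫ objι a = e' ≫ objι a) : e = e' :=
  (loc_of_comp_objι_eq e e' h).eq fun _ _ hs => eq_of_heq (Sigma.mk.inj_iff.1 hs).2

lemma arrι_cancel {f f' : T ⟶ M.splitArr a b} (h : f ≫ arrι a b = f' ≫ arrι a b) : f = f' :=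
  (loc_of_comp_arrι_eq f f' h).eq fun _ _ hs => eq_of_heq (Sigma.mk.inj_iff.1 hs).2

end

variable (M) in
/-- The domain `e` of `(d, f, e)`. -/
def intDom : M.intArr ⟶ M.intObj := arrDesc fun a _ => src (𝟙 _) ≫ objι a

variable (M) in
/-- The codomain `d` of `(d, f, e)`. -/
def intCod : M.intArr ⟶ M.intObj := arrDesc fun _ b => tgt (𝟙 _) ≫ objι b

variable (M) in
/-- The identity `(e, e, e)` of `e`. -/
def intIdent : M.intObj ⟶ M.intArr := objDesc fun a => idSplit (𝟙 _) ≫ arrι a a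

@[simp]
lemma arrι_intDom (f : T ⟶ M.splitArr a b) : f ≫ arrι a b ≫ M.intDom = src f ≫ objι a := by
  rw [intDom, arrι_desc, ← Category.assoc, ← src_comp, Category.comp_id]

@[simp]
lemma arrι_intCod (f : T ⟶ M.splitArr a b) : f ≫ arrι a b ≫ M.intCod = tgt f ≫ objι b := by
  rw [intCod, arrι_desc, ← Category.assoc, ← tgt_comp, Category.comp_id]

@[simp]
lemma objι_intIdent (e : T ⟶ M.idem a) : e ≫ objι a ≫ M.intIdent = idSplit e ≫ arrι a a := by
  rw [intIdent, objι_desc, ← Category.assoc, comp_idSplit, Category.comp_id]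

lemma arrι_intDom_intIdent (f : T ⟶ M.splitArr a b) :
    f ≫ arrι a b ≫ M.intDom ≫ M.intIdent = idSplit (src f) ≫ arrι a a := by
  rw [← objι_intIdent, ← Category.assoc (src f), ← arrι_intDom]
  simp only [Category.assoc]

lemma arrι_intCod_intIdent (f : T ⟶ M.splitArr a b) :
    f ≫ arrι a b ≫ M.intCod ≫ M.intIdent = idSplit (tgt f) ≫ arrι b b := by
  rw [← objι_intIdent, ← Category.assoc (tgt f), ← arrι_intCod]
  simp only [Category.assoc]

variable [Extensive.{w} V]

/-- A local representative of `f` ends at some `b'`, and its target agrees with `e` in the coproduct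
of all idempotents. Disjointness forces `b' = b` on a finer decomposition. In this way an arrow is
aligned with a representative already chosen for its left neighbour. -/
lemma loc_of_dom_eq (e : T ⟶ M.idem b) (f : T ⟶ M.intArr) (h : e ≫ objι b = f ≫ M.intCod) :
    Loc.{w} fun S s => ∃ a, ∃ f' : S ⟶ M.splitArr a b, s ≫ f = f' ≫ arrι a b ∧
      s ≫ e = tgt f' := by
  refine (loc_arr f).bind fun S s ⟨a, b', f', hf⟩ => ?_
  have h₁ : (s ≫ e) ≫ objι b = tgt f' ≫ objι b' := by
    rw [← arrι_intCod, ← Category.assoc, ← hf, Category.assoc, h, Category.assoc]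
  refine (loc_of_comp_objι_eq _ _ h₁).mono fun S' r hr => ?_
  obtain ⟨rfl, hr⟩ := Sigma.mk.inj_iff.1 hr
  refine ⟨a, r ≫ f', by simp [hf], ?_⟩
  rw [Category.assoc, eq_of_heq hr, tgt_comp]

lemma loc_composable (g f : T ⟶ M.intArr) (h : g ≫ M.intDom = f ≫ M.intCod) :
    Loc.{w} fun S s => ∃ a b c, ∃ (g' : S ⟶ M.splitArr b c) (f' : S ⟶ M.splitArr a b),
      s ≫ g = g' ≫ arrι b c ∧ s ≫ f = f' ≫ arrι a b ∧ src g' = tgt f' := by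
  refine (loc_arr g).bind fun S s ⟨b, c, g', hg⟩ => ?_
  refine (loc_of_dom_eq (src g') (s ≫ f) ?_).mono fun S' r ⟨a, f', hf, hf'⟩ => ?_
  · rw [← arrι_intDom, ← Category.assoc, ← hg, Category.assoc, h, Category.assoc]
  · exact ⟨a, b, c, r ≫ g', f', by simp [hg], by simpa using hf, by simpa using hf'⟩

/-- Two representatives of the same arrow locally have equal indices and equal components, so the
composite cannot depend on them. Composability plays no role because `compSplit` is total. -/
lemma compSplit_arrι_eq {a' b' c' : M.carrier} {g : T ⟶ M.splitArr b c} {f : T ⟶ M.splitArr a b}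
    {g' : T ⟶ M.splitArr b' c'} {f' : T ⟶ M.splitArr a' b'} (hg : g ≫ arrι b c = g' ≫ arrι b' c')
    (hf : f ≫ arrι a b = f' ≫ arrι a' b') :
    compSplit g f ≫ arrι a c = compSplit g' f' ≫ arrι a' c' := by
  refine (loc_of_comp_arrι_eq _ _ hg).eq fun S s hs => ?_
  have hf₁ : (s ≫ f) ≫ arrι a b = (s ≫ f') ≫ arrι a' b' := by simp [hf]
  refine (loc_of_comp_arrι_eq _ _ hf₁).eq fun S' r hr => ?_
  obtain ⟨h₁, h₂⟩ := Sigma.mk.inj_iff.1 hs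
  obtain ⟨h₃, h₄⟩ := Sigma.mk.inj_iff.1 hr
  obtain ⟨rfl, rfl⟩ := Prod.mk_inj.1 h₁
  obtain ⟨rfl, -⟩ := Prod.mk_inj.1 h₃
  have h₅ := eq_of_heq h₂
  have h₆ := eq_of_heq h₄
  rw [← Category.assoc s, ← Category.assoc s, comp_compSplit, comp_compSplit, h₅, ← Category.assoc,
    ← Category.assoc, comp_compSplit, comp_compSplit, h₆]

-- A composable pair locally has representatives with matching middle index, and their composite is
-- independent of the choice, so the local composites glue.
variable (M) in
lemma exists_intComp : ∃ k : pullback M.intDom M.intCod ⟶ M.intArr,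
    ∀ ⦃S : V⦄ (s : S ⟶ pullback M.intDom M.intCod) (y : S ⟶ M.intArr),
      (∃ a b c, ∃ (g : S ⟶ M.splitArr b c) (f : S ⟶ M.splitArr a b),
        s ≫ pullback.fst _ _ = g ≫ arrι b c ∧ s ≫ pullback.snd _ _ = f ≫ arrι a b ∧
          y = compSplit g f ≫ arrι a c) → s ≫ k = y := by
  refine exists_glue (fun S s y => ∃ a b c, ∃ (g : S ⟶ M.splitArr b c) (f : S ⟶ M.splitArr a b),
        s ≫ pullback.fst _ _ = g ≫ arrι b c ∧ s ≫ pullback.snd _ _ = f ≫ arrι a b ∧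
          y = compSplit g f ≫ arrι a c) ?_ ?_ ?_
  · rintro S S' r s z ⟨a, b, c, g, f, hg, hf, rfl⟩
    refine ⟨a, b, c, r ≫ g, r ≫ f, by simp [hg], by simp [hf], ?_⟩
    rw [← Category.assoc, comp_compSplit]
  · rintro S s z z' ⟨a, b, c, g, f, hg, hf, rfl⟩ ⟨a', b', c', g', f', hg', hf', rfl⟩
    exact compSplit_arrι_eq (hg.symm.trans hg') (hf.symm.trans hf')
  · exact (loc_composable _ _ pullback.condition).mono fun S s ⟨a, b, c, g, f, hg, hf, _⟩ =>
      ⟨_, a, b, c, g, f, hg, hf, rfl⟩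

variable (M) in
/-- The data of the internal category of idempotents. -/
abbrev intData : InternalCategoryData V where
  obj := M.intObj
  arr := M.intArr
  dom := M.intDom
  cod := M.intCod
  ident := M.intIdent
  comp := (exists_intComp M).choose

/-- The composition is obtained by choice; its value on representatives is all that is used of it.
-/
lemma intData_comp {s : T ⟶ pullback M.intDom M.intCod} {g : T ⟶ M.splitArr b c}
    {f : T ⟶ M.splitArr a b} (hg : s ≫ pullback.fst _ _ = g ≫ arrι b c)
    (hf : s ≫ pullback.snd _ _ = f ≫ arrι a b) :
    s ≫ M.intData.comp = compSplit g f ≫ arrι a c :=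
  (exists_intComp M).choose_spec _ _ ⟨a, b, c, g, f, hg, hf, rfl⟩

lemma intData_compose {x y : T ⟶ M.intArr} (h : x ≫ M.intDom = y ≫ M.intCod)
    {g : T ⟶ M.splitArr b c} {f : T ⟶ M.splitArr a b} (hg : x = g ≫ arrι b c)
    (hf : y = f ≫ arrι a b) :
    M.intData.compose x y h = compSplit g f ≫ arrι a c :=
  intData_comp ((pullback.lift_fst _ _ _).trans hg) ((pullback.lift_snd _ _ _).trans hf)

variable (M) in
/-- The internal category of idempotents of an enriched category. -/
abbrev intCat : InternalCategory V where
  toInternalCategoryData := M.intData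
  ident_dom := intObj_ext fun a => by
    have h₁ := objι_intIdent (𝟙 (M.idem a)) =≫ M.intDom
    rw [Category.assoc, Category.assoc, Category.assoc, arrι_intDom, src_idSplit,
      Category.id_comp, Category.id_comp] at h₁
    rw [h₁, Category.comp_id]
  ident_cod := intObj_ext fun a => by
    have h₁ := objι_intIdent (𝟙 (M.idem a)) =≫ M.intCod
    rw [Category.assoc, Category.assoc, Category.assoc, arrι_intCod, tgt_idSplit,
      Category.id_comp, Category.id_comp] at h₁
    rw [h₁, Category.comp_id]
  comp_dom := by
    refine (loc_composable _ _ pullback.condition).eq fun S s ⟨a, b, c, g, f, hg, hf, _⟩ => ?_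
    rw [← Category.assoc, intData_comp hg hf, ← Category.assoc s, hf,
      Category.assoc, Category.assoc, arrι_intDom, arrι_intDom, src_compSplit]
  comp_cod := by
    refine (loc_composable _ _ pullback.condition).eq fun S s ⟨a, b, c, g, f, hg, hf, _⟩ => ?_
    rw [← Category.assoc, intData_comp hg hf, ← Category.assoc s, hg,
      Category.assoc, Category.assoc, arrι_intCod, arrι_intCod, tgt_compSplit]
  ident_comp h := intArr_ext fun a b => by
    refine (InternalCategoryData.precomp_compose ..).trans ?_
    refine (intData_compose (g := idSplit (tgt (𝟙 _))) (f := 𝟙 (M.splitArr a b)) _ ?_ ?_).trans ?_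
    · exact (Category.id_comp _).symm.trans (arrι_intCod_intIdent _)
    · exact (Category.comp_id _).trans (Category.id_comp _).symm
    · rw [idSplit_compSplit]
      exact (Category.id_comp _).trans (Category.comp_id _).symm
  comp_ident h := intArr_ext fun a b => by
    refine (InternalCategoryData.precomp_compose ..).trans ?_
    refine (intData_compose (g := 𝟙 (M.splitArr a b)) (f := idSplit (src (𝟙 _))) _ ?_ ?_).trans ?_
    · exact (Category.comp_id _).trans (Category.id_comp _).symm
    · exact (Category.id_comp _).symm.trans (arrι_intDom_intIdent _)
    · rw [compSplit_idSplit]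
      exact (Category.id_comp _).trans (Category.comp_id _).symm
  assoc {T} k g f hkg hgf h₁ h₂ := by
    -- Representatives of `k` and `g` come first. That of `f` is then chosen to end at the source of
    -- `g'`, so that the three triples share their intermediate indices and `compSplit_assoc`
    -- applies.
    refine (loc_composable k g hkg).eq fun S s ⟨b, c, d, k', g', hk, hg, _⟩ => ?_
    refine (loc_of_dom_eq (src g') (s ≫ f) ?_).eq fun S' r ⟨a, f', hf, _⟩ => ?_
    · rw [← arrι_intDom, ← Category.assoc, ← hg, Category.assoc]
      exact (s ≫= hgf).trans (Category.assoc _ _ _).symm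
    · simp only [← Category.assoc]
      refine (InternalCategoryData.precomp_compose ..).trans
        (Eq.trans ?_ (InternalCategoryData.precomp_compose ..).symm)
      have hk₁ : (r ≫ s) ≫ k = (r ≫ k') ≫ arrι c d := by rw [Category.assoc, hk, Category.assoc]
      have hg₁ : (r ≫ s) ≫ g = (r ≫ g') ≫ arrι b c := by rw [Category.assoc, hg, Category.assoc]
      have hf₁ : (r ≫ s) ≫ f = f' ≫ arrι a b := by rw [Category.assoc, hf]
      refine (intData_compose (g := compSplit (r ≫ k') (r ≫ g')) _ ?_ hf₁).trans
        (Eq.trans ?_ (intData_compose (f := compSplit (r ≫ g') f') _ hk₁ ?_).symm)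
      · rw [InternalCategoryData.precomp_compose, intData_compose _ hk₁ hg₁]
      · rw [compSplit_assoc]
      · rw [InternalCategoryData.precomp_compose, intData_compose _ hg₁ hf₁]

lemma intCat_compose {x y : T ⟶ M.intArr} (h : x ≫ M.intDom = y ≫ M.intCod)
    {g : T ⟶ M.splitArr b c} {f : T ⟶ M.splitArr a b} (hg : x = g ≫ arrι b c)
    (hf : y = f ≫ arrι a b) :
    M.intCat.compose x y h = compSplit g f ≫ arrι a c :=
  intData_compose h hg hf

lemma comp_intCat_compose {s : S ⟶ T} {x y : T ⟶ M.intArr} (h : x ≫ M.intDom = y ≫ M.intCod)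
    {g : S ⟶ M.splitArr b c} {f : S ⟶ M.splitArr a b} (hg : s ≫ x = g ≫ arrι b c)
    (hf : s ≫ y = f ≫ arrι a b) :
    s ≫ M.intCat.compose x y h = compSplit g f ≫ arrι a c :=
  (M.intCat.comp_compose s x y h).trans (intCat_compose _ hg hf)

end IntData

end VCat

/-! ### Monomorphisms between coproducts and local lifting -/

section Covers

variable {V : Type u} [Category.{v} V] [HasCoproducts.{w} V] [Extensive.{w} V]

lemma sigmaι_cancel {I : Type w} {X : I → V} {T : V} {i : I} {f g : T ⟶ X i}
    (h : f ≫ Sigma.ι X i = g ≫ Sigma.ι X i) : f = g :=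
  (loc_of_comp_sigmaι_eq f g h).eq fun _ _ hs => eq_of_heq (Sigma.mk.inj_iff.1 hs).2

/-- Two elements with the same image lie locally in summands `i` and `j`. Disjointness of the target
gives `σ i = σ j` locally, hence `i = j`, and then `m i` can be cancelled. -/
lemma mono_sigmaDesc {I J : Type w} {X : I → V} {Y : J → V} (σ : I → J)
    (hσ : Function.Injective σ) (m : ∀ i, X i ⟶ Y (σ i)) [∀ i, Mono (m i)] :
    Mono (Sigma.desc fun i => m i ≫ Sigma.ι Y (σ i)) := by
  refine ⟨fun {T} f g h => ?_⟩
  refine ((isCover_sigmaι X).loc f).eq fun S s ⟨i, x, hx⟩ => ?_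
  refine ((isCover_sigmaι X).loc (s ≫ g)).eq fun S' r ⟨j, y, hy⟩ => ?_
  have h₁ : ((r ≫ x) ≫ m i) ≫ Sigma.ι Y (σ i) = (y ≫ m j) ≫ Sigma.ι Y (σ j) := by
    have h₂ := (r ≫ s) ≫= h
    simp only [Category.assoc, reassoc_of% hx] at h₂
    have h₃ := hy =≫ Sigma.desc fun i => m i ≫ Sigma.ι Y (σ i)
    simp only [Category.assoc] at h₃
    rw [h₃] at h₂
    simpa using h₂
  refine (loc_of_comp_sigmaι_eq _ _ h₁).eq fun S'' q hq => ?_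
  obtain ⟨hij, hq⟩ := Sigma.mk.inj_iff.1 hq
  obtain rfl := hσ hij
  have h₄ : q ≫ r ≫ x = q ≫ y := by
    rw [← cancel_mono (m i)]
    simpa using eq_of_heq hq
  rw [hy, hx, ← Category.assoc r, ← Category.assoc q, h₄, Category.assoc]

/-- Lifts through a monomorphism are unique, so local ones glue. The universal properties of the two
equalizers in `IntPresentation` are thereby reduced to the components. -/
lemma existsUnique_lift_of_mono {T X Y : V} (m : X ⟶ Y) [Mono m] (k : T ⟶ Y)
    (h : Loc.{w} fun S (s : S ⟶ T) => ∃ y : S ⟶ X, y ≫ m = s ≫ k) : ∃! l : T ⟶ X, l ≫ m = k := by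
  obtain ⟨z, hz⟩ := exists_glue (fun S (s : S ⟶ T) (y : S ⟶ X) => y ≫ m = s ≫ k)
    (fun S S' r s z hz => by rw [Category.assoc, hz, Category.assoc])
    (fun S s z z' hz hz' => by rw [← cancel_mono m, hz, hz']) h
  refine ⟨z, h.eq fun S s ⟨y, hy⟩ => ?_, fun z' hz' => ?_⟩
  · rw [← Category.assoc, hz s y hy, hy]
  · rw [← cancel_mono m, hz']
    refine h.eq fun S s ⟨y, hy⟩ => ?_
    rw [← Category.assoc, hz s y hy, hy]

end Covers

namespace VCat

/-! ## The splitting of idempotents -/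

section IntSplitting

variable {V : Type u} [Category.{v} V] [CartesianMonoidalCategory V] [HasFiniteLimits V]
  {M : VCat.{w} V} {T S : V} {a b c d : M.carrier}

local infixr:80 " ⊙ " => VCat.cmp

/-- The idempotent `p` absorbs the idempotent `e` on both sides. -/
structure Absorbs (p e : T ⟶ M.idem a) : Prop where
  left : (e ≫ M.idemι a) ⊙ (p ≫ M.idemι a) = p ≫ M.idemι a
  right : (p ≫ M.idemι a) ⊙ (e ≫ M.idemι a) = p ≫ M.idemι a

lemma Absorbs.comp {p e : T ⟶ M.idem a} (h : Absorbs p e) (s : S ⟶ T) :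
    Absorbs (s ≫ p) (s ≫ e) :=
  ⟨by simp only [Category.assoc, ← comp_cmp, h.left], by
    simp only [Category.assoc, ← comp_cmp, h.right]⟩

/-- The endomorphism `(e, p, e)` of `e`. -/
def endSplit (e p : T ⟶ M.idem a) (h : Absorbs p e) : T ⟶ M.splitArr a a :=
  mkSplit e (p ≫ M.idemι a) e h.left h.right

/-- The retraction `(p, p, e)`. -/
def retrSplit (e p : T ⟶ M.idem a) (h : Absorbs p e) : T ⟶ M.splitArr a a :=
  mkSplit p (p ≫ M.idemι a) e (by simp) h.right

/-- The section `(e, p, p)`. -/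
def secSplit (e p : T ⟶ M.idem a) (h : Absorbs p e) : T ⟶ M.splitArr a a :=
  mkSplit e (p ≫ M.idemι a) p h.left (by simp)

section

variable (e p : T ⟶ M.idem a) (h : Absorbs p e)

@[simp] lemma src_endSplit : src (endSplit e p h) = e := src_mkSplit ..
@[simp] lemma mid_endSplit : mid (endSplit e p h) = p ≫ M.idemι a := mid_mkSplit ..
@[simp] lemma tgt_endSplit : tgt (endSplit e p h) = e := tgt_mkSplit ..
@[simp] lemma src_retrSplit : src (retrSplit e p h) = e := src_mkSplit ..
@[simp] lemma mid_retrSplit : mid (retrSplit e p h) = p ≫ M.idemι a := mid_mkSplit ..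
@[simp] lemma tgt_retrSplit : tgt (retrSplit e p h) = p := tgt_mkSplit ..
@[simp] lemma src_secSplit : src (secSplit e p h) = p := src_mkSplit ..
@[simp] lemma mid_secSplit : mid (secSplit e p h) = p ≫ M.idemι a := mid_mkSplit ..
@[simp] lemma tgt_secSplit : tgt (secSplit e p h) = e := tgt_mkSplit ..

lemma comp_endSplit (s : S ⟶ T) : s ≫ endSplit e p h = endSplit (s ≫ e) (s ≫ p) (h.comp s) := by
  apply split_ext <;> simp only [src_comp, mid_comp, tgt_comp, src_endSplit, mid_endSplit,
    tgt_endSplit, Category.assoc]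

lemma comp_retrSplit (s : S ⟶ T) :
    s ≫ retrSplit e p h = retrSplit (s ≫ e) (s ≫ p) (h.comp s) := by
  apply split_ext <;> simp only [src_comp, mid_comp, tgt_comp, src_retrSplit, mid_retrSplit,
    tgt_retrSplit, Category.assoc]

lemma comp_secSplit (s : S ⟶ T) : s ≫ secSplit e p h = secSplit (s ≫ e) (s ≫ p) (h.comp s) := by
  apply split_ext <;> simp only [src_comp, mid_comp, tgt_comp, src_secSplit, mid_secSplit,
    tgt_secSplit, Category.assoc]

end

lemma absorbs_refl (e : T ⟶ M.idem a) : Absorbs e e := ⟨by simp, by simp⟩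

variable [HasCoproducts.{w} V]

lemma comp_retrSplit_arrι (s : S ⟶ T) (e p : T ⟶ M.idem a) (h : Absorbs p e) :
    s ≫ retrSplit e p h ≫ arrι a a = retrSplit (s ≫ e) (s ≫ p) (h.comp s) ≫ arrι a a := by
  rw [← Category.assoc, comp_retrSplit]

lemma comp_secSplit_arrι (s : S ⟶ T) (e p : T ⟶ M.idem a) (h : Absorbs p e) :
    s ≫ secSplit e p h ≫ arrι a a = secSplit (s ≫ e) (s ≫ p) (h.comp s) ≫ arrι a a := by
  rw [← Category.assoc, comp_secSplit]

variable [Extensive.{w} V]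

/-- Codomain and domain of the idempotent are both `e`, so a representative can be aligned with `e`
first at its target and then at its source. Its middle component is idempotent because `arrι` can be
cancelled. Prescribing `e` allows two idempotents on the same object to be represented over the same
`e`. -/
lemma loc_idem_of_src (k : T ⟶ M.intCat.idem) (e : T ⟶ M.idem a)
    (h : k ≫ M.intCat.idemι ≫ M.intDom = e ≫ objι a) :
    Loc.{w} fun S s => ∃ (p : S ⟶ M.idem a) (hp : Absorbs p (s ≫ e)),
      s ≫ k ≫ M.intCat.idemι = endSplit (s ≫ e) p hp ≫ arrι a a := by
  have hk : k ≫ M.intCat.idemι ≫ M.intCod = e ≫ objι a := by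
    rw [← h]
    exact k ≫= M.intCat.idemι_condition.symm
  refine (loc_of_dom_eq e (k ≫ M.intCat.idemι) (by rw [Category.assoc, hk])).bind
    fun S s ⟨b, f, hf, hf'⟩ => ?_
  have h₁ : src f ≫ objι b = (s ≫ e) ≫ objι a := by
    rw [← arrι_intDom, ← Category.assoc, ← hf, Category.assoc, Category.assoc, h, Category.assoc]
  refine (loc_of_comp_objι_eq _ _ h₁).mono fun S' r hr => ?_
  obtain ⟨rfl, hr⟩ := Sigma.mk.inj_iff.1 hr
  have hsrc := eq_of_heq hr
  have hrf : (r ≫ s) ≫ k ≫ M.intCat.idemι = (r ≫ f) ≫ arrι b b := by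
    rw [Category.assoc, hf, Category.assoc]
  have hrf' : ((r ≫ s) ≫ k) ≫ M.intCat.idemι = (r ≫ f) ≫ arrι b b := by
    rw [Category.assoc, hrf]
  have h₂ := ((r ≫ s) ≫ k) ≫= M.intCat.idemι_idem
  rw [comp_intCat_compose _ hrf' hrf', hrf'] at h₂
  have h₃ : (r ≫ mid f) ⊙ (r ≫ mid f) = r ≫ mid f := by
    simpa using congrArg mid (arrι_cancel h₂)
  have h₄ : (r ≫ s) ≫ e = r ≫ tgt f := by rw [Category.assoc, hf']
  rw [← Category.assoc] at hsrc
  refine ⟨mkIdem (r ≫ mid f) h₃, ⟨?_, ?_⟩, hrf.trans ?_⟩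
  · rw [mkIdem_ι, h₄, Category.assoc, ← comp_cmp, tgt_cmp_mid]
  · rw [mkIdem_ι, ← hsrc, Category.assoc, ← comp_cmp, mid_cmp_src]
  · congr 1
    apply split_ext <;> simp only [src_comp, mid_comp, tgt_comp, src_endSplit, mid_endSplit,
      tgt_endSplit, mkIdem_ι, h₄, hsrc]

lemma loc_idem (k : T ⟶ M.intCat.idem) :
    Loc.{w} fun S s => ∃ (a : M.carrier) (e p : S ⟶ M.idem a) (hp : Absorbs p e),
      s ≫ k ≫ M.intCat.idemι = endSplit e p hp ≫ arrι a a := by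
  refine (loc_obj (k ≫ M.intCat.idemι ≫ M.intDom)).bind fun S s ⟨a, e, he⟩ => ?_
  refine (loc_idem_of_src (s ≫ k) e (by rw [Category.assoc, he])).mono fun S' r ⟨p, hp, h⟩ => ?_
  exact ⟨a, r ≫ e, p, hp, by simpa using h⟩

/-- A formula in the pair (e, p) that is natural in the stage defines an arrow on all idempotents:
the form (e, p, e) exists locally, and two such forms of one idempotent agree locally. -/
lemma exists_idemDesc {Z : V} (K : ∀ ⦃S : V⦄ ⦃a : M.carrier⦄ (e p : S ⟶ M.idem a),
      Absorbs p e → (S ⟶ Z))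
    (hK : ∀ ⦃S S' : V⦄ ⦃a : M.carrier⦄ (r : S' ⟶ S) (e p : S ⟶ M.idem a) (h : Absorbs p e),
      r ≫ K e p h = K (r ≫ e) (r ≫ p) (h.comp r)) :
    ∃ z : M.intCat.idem ⟶ Z, ∀ ⦃S : V⦄ (s : S ⟶ M.intCat.idem) (y : S ⟶ Z),
      (∃ (a : M.carrier) (e p : S ⟶ M.idem a) (h : Absorbs p e),
      s ≫ M.intCat.idemι = endSplit e p h ≫ arrι a a ∧ y = K e p h) → s ≫ z = y := by
  refine exists_glue (fun S s y => ∃ (a : M.carrier) (e p : S ⟶ M.idem a) (h : Absorbs p e),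
    s ≫ M.intCat.idemι = endSplit e p h ≫ arrι a a ∧ y = K e p h) ?_ ?_ ?_
  · rintro S S' r s z ⟨a, e, p, h, hs, rfl⟩
    refine ⟨a, r ≫ e, r ≫ p, h.comp r, ?_, hK r e p h⟩
    rw [← comp_endSplit, Category.assoc, hs, Category.assoc]
  · rintro S s z z' ⟨a, e, p, h, hs, rfl⟩ ⟨a', e', p', h', hs', rfl⟩
    refine (loc_of_comp_arrι_eq _ _ (hs.symm.trans hs')).eq fun S' r hr => ?_
    obtain ⟨h₁, hr⟩ := Sigma.mk.inj_iff.1 hr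
    obtain ⟨rfl, -⟩ := Prod.mk_inj.1 h₁
    have h₂ := eq_of_heq hr
    have he : r ≫ e = r ≫ e' := by simpa using congrArg src h₂
    have hp : r ≫ p = r ≫ p' := idem_ext (by simpa using congrArg mid h₂)
    simp only [hK, he, hp]
  · refine (loc_idem (𝟙 M.intCat.idem)).mono fun S s ⟨a, e, p, hp, h⟩ => ?_
    exact ⟨_, a, e, p, hp, by simpa using h, rfl⟩

variable (M) in
/-- The retractions `(p, p, e)` of the idempotents `(e, p, e)`. -/
def intR : M.intCat.idem ⟶ M.intArr :=
  (exists_idemDesc (M := M) (fun _ a e p h => retrSplit e p h ≫ arrι a a)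
    (fun _ _ _ => comp_retrSplit_arrι)).choose

variable (M) in
/-- The sections `(e, p, p)` of the idempotents `(e, p, e)`. -/
def intS : M.intCat.idem ⟶ M.intArr :=
  (exists_idemDesc (M := M) (fun _ a e p h => secSplit e p h ≫ arrι a a)
    (fun _ _ _ => comp_secSplit_arrι)).choose

lemma comp_intR {k : T ⟶ M.intCat.idem} {e p : T ⟶ M.idem a} {h : Absorbs p e}
    (hk : k ≫ M.intCat.idemι = endSplit e p h ≫ arrι a a) :
    k ≫ M.intR = retrSplit e p h ≫ arrι a a :=
  (exists_idemDesc (M := M) (fun _ a e p h => retrSplit e p h ≫ arrι a a)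
    (fun _ _ _ => comp_retrSplit_arrι)).choose_spec _ _
    ⟨a, e, p, h, hk, rfl⟩

lemma comp_intS {k : T ⟶ M.intCat.idem} {e p : T ⟶ M.idem a} {h : Absorbs p e}
    (hk : k ≫ M.intCat.idemι = endSplit e p h ≫ arrι a a) :
    k ≫ M.intS = secSplit e p h ≫ arrι a a :=
  (exists_idemDesc (M := M) (fun _ a e p h => secSplit e p h ≫ arrι a a)
    (fun _ _ _ => comp_secSplit_arrι)).choose_spec _ _
    ⟨a, e, p, h, hk, rfl⟩

variable (M) in
/-- The chosen splitting of the idempotents `(e, p, e)`. -/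
abbrev intSplitting : M.intCat.Splitting where
  R := M.intR
  S := M.intS
  R_dom := (loc_idem (𝟙 M.intCat.idem)).eq fun T s ⟨a, e, p, hp, h⟩ => by
    rw [Category.id_comp] at h
    rw [← Category.assoc, comp_intR h, ← Category.assoc, h, Category.assoc, Category.assoc,
      arrι_intDom, arrι_intDom, src_retrSplit, src_endSplit]
  S_cod := (loc_idem (𝟙 M.intCat.idem)).eq fun T s ⟨a, e, p, hp, h⟩ => by
    rw [Category.id_comp] at h
    rw [← Category.assoc, comp_intS h, ← Category.assoc, h, Category.assoc, Category.assoc,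
      arrι_intDom, arrι_intCod, tgt_secSplit, src_endSplit]
  R_cod := (loc_idem (𝟙 M.intCat.idem)).eq fun T s ⟨a, e, p, hp, h⟩ => by
    rw [Category.id_comp] at h
    rw [← Category.assoc, comp_intR h, ← Category.assoc, comp_intS h, Category.assoc,
      Category.assoc, arrι_intDom, arrι_intCod, tgt_retrSplit, src_secSplit]
  S_comp_R _ := (loc_idem (𝟙 M.intCat.idem)).eq fun T s ⟨a, e, p, hp, h⟩ => by
    rw [Category.id_comp] at h
    rw [comp_intCat_compose _ (comp_intS h) (comp_intR h), h]
    congr 1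
    apply split_ext <;> simp
  R_comp_S _ := (loc_idem (𝟙 M.intCat.idem)).eq fun T s ⟨a, e, p, hp, h⟩ => by
    rw [Category.id_comp] at h
    rw [comp_intCat_compose _ (comp_intR h) (comp_intS h),
      Category.assoc, ← Category.assoc s, comp_intS h, Category.assoc, arrι_intDom_intIdent]
    congr 1
    apply split_ext <;> simp

/-- Locally f = (e, p, e) and g = (e, q, e), and f g f = g means p q p = q, whence p q = q = q p.
Then k = (p, p, e)(e, q, e)(e, p, p) = (p, q, p). Its retraction is (q, q, p) = (q, q, e)(e, p, p)
and its section is (p, q, q) = (p, p, e)(e, q, q). -/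
lemma intSplitting_isCanonical : M.intSplitting.IsCanonical := by
  have hid (a : M.carrier) : (objι a ≫ M.intCat.identIdem) ≫ M.intCat.idemι =
      endSplit (𝟙 _) (𝟙 _) (absorbs_refl _) ≫ arrι a a := by
    rw [Category.assoc, InternalCategory.identIdem, InternalCategory.idemLift_ι,
      ← Category.id_comp (objι a), Category.assoc, objι_intIdent]
    rfl
  refine ⟨intObj_ext fun a => ?_, intObj_ext fun a => ?_, ?_, ?_⟩
  · rw [← Category.assoc, comp_intR (hid a), ← Category.id_comp (objι a), Category.assoc,
      objι_intIdent]
    rfl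
  · rw [← Category.assoc, comp_intS (hid a), ← Category.id_comp (objι a), Category.assoc,
      objι_intIdent]
    rfl
  all_goals
    intro T f g k _ hgf hfgf hgs hrgs hrs h hk
    refine (loc_idem f).eq fun S s ⟨a, e, p, hp, hf⟩ => ?_
    have hg₁ : (s ≫ g) ≫ M.intCat.idemι ≫ M.intDom = e ≫ objι a := by
      have h₁ := s ≫= hgf
      have h₂ := hf =≫ M.intCod
      simp only [Category.assoc] at h₁ h₂ ⊢
      rw [h₁, h₂, arrι_intCod, tgt_endSplit]
    refine (loc_idem_of_src (s ≫ g) e hg₁).eq fun S' r ⟨q, hq, hg⟩ => ?_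
    have hf' : ((r ≫ s) ≫ f) ≫ M.intCat.idemι =
        endSplit (r ≫ e) (r ≫ p) (hp.comp r) ≫ arrι a a := by
      rw [← comp_endSplit, Category.assoc, Category.assoc, hf, Category.assoc]
    have hg' : ((r ≫ s) ≫ g) ≫ M.intCat.idemι = endSplit (r ≫ e) q hq ≫ arrι a a := by
      rw [← hg]
      simp only [Category.assoc]
    have hfR := (Category.assoc _ _ _).symm.trans (comp_intR hf')
    have hfS := (Category.assoc _ _ _).symm.trans (comp_intS hf')
    have hgR := (Category.assoc _ _ _).symm.trans (comp_intR hg')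
    have hgS := (Category.assoc _ _ _).symm.trans (comp_intS hg')
    rw [Category.assoc] at hf' hg'
    have h' := (r ≫ s) ≫= h
    rw [comp_intCat_compose _ hf' (comp_intCat_compose _ hg' hf'), hg'] at h'
    have h'' := congrArg mid (arrι_cancel h')
    simp only [mid_compSplit, mid_endSplit] at h''
    have hqp : Absorbs q (r ≫ p) := ⟨by rw [← h'', idem_cmp_idem_cmp], by
      rw [← h'', cmp_assoc, cmp_assoc, idem_cmp_idem]⟩
    have hk' : ((r ≫ s) ≫ k) ≫ M.intCat.idemι = endSplit (r ≫ p) q hqp ≫ arrι a a := by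
      rw [Category.assoc, hk, comp_intCat_compose _ hfR (comp_intCat_compose _ hg' hfS)]
      congr 1
      apply split_ext <;> simp [hqp.left, hqp.right, -Category.assoc]
    rw [← Category.assoc, ← Category.assoc, ← Category.assoc r]
    first
    | rw [comp_intR hk', comp_intCat_compose _ hgR hfS]
    | rw [comp_intS hk', comp_intCat_compose _ hfR hgS]
    congr 1
    apply split_ext <;> simp [hqp.left, hqp.right, -Category.assoc]

end IntSplitting

/-! ### Arrows into the coproduct of all hom-objects -/

section Homs

variable {V : Type u} [Category.{v} V] [CartesianMonoidalCategory V] [HasCoproducts.{w} V]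
  {M : VCat.{w} V} {T : V} {a b c d : M.carrier}

variable (M) in
/-- The injection of a component. -/
abbrev homsι (a b : M.carrier) : M.hom a b ⟶ M.homs :=
  Sigma.ι (fun q : M.carrier × M.carrier => M.hom q.1 q.2) (a, b)

variable [Extensive.{w} V]

lemma loc_of_comp_homsι_eq {f : T ⟶ M.hom a b} {g : T ⟶ M.hom c d}
    (h : f ≫ M.homsι a b = g ≫ M.homsι c d) :
    Loc.{w} fun S s => (⟨(a, b), s ≫ f⟩ : Σ q : M.carrier × M.carrier, S ⟶ M.hom q.1 q.2) =
      ⟨(c, d), s ≫ g⟩ :=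
  loc_of_comp_sigmaι_eq (X := fun q : M.carrier × M.carrier => M.hom q.1 q.2) (i := (a, b))
    (j := (c, d)) f g h

end Homs

/-! ## The functor `Int` -/

section IntFunctor

variable {V : Type u} [Category.{v} V] [CartesianMonoidalCategory V] [HasFiniteLimits V]
  {M : VCat.{w} V} {T S : V} {a b c d : M.carrier}

local infixr:80 " ⊙ " => VCat.cmp

/-- A point of `splitArr` is determined by its three underlying arrows, each of which ranges over a
small set. -/
instance small_splitArr (a b : M.carrier) : Small.{w} (𝟙_ V ⟶ M.splitArr a b) :=
  haveI := M.small
  small_of_injective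
    (β := (𝟙_ V ⟶ (b ⟶[V] b)) × (𝟙_ V ⟶ (a ⟶[V] b)) × (𝟙_ V ⟶ (a ⟶[V] a)))
    (f := fun x => (tgt x ≫ M.idemι b, mid x, src x ≫ M.idemι a)) (fun x y h => by
      simp only [Prod.mk.injEq] at h
      exact split_ext (idem_ext h.1) h.2.1 (idem_ext h.2.2))

variable [HasCoproducts.{w} V]

variable (M) in
/-- The inclusion of the idempotents into the composable pairs. -/
def intε : M.intObj ⟶ M.pairs :=
  Sigma.desc fun a : M.carrier => lift (M.idemι a) (M.idemι a) ≫
    Sigma.ι (fun p : M.carrier × M.carrier × M.carrier =>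
      M.hom p.2.1 p.2.2 ⊗ M.hom p.1 p.2.1) (a, a, a)

lemma objι_intε (a : M.carrier) : objι a ≫ M.intε = lift (M.idemι a) (M.idemι a) ≫
    Sigma.ι (fun p : M.carrier × M.carrier × M.carrier =>
      M.hom p.2.1 p.2.2 ⊗ M.hom p.1 p.2.1) (a, a, a) :=
  Sigma.ι_desc _ _

variable (M) in
/-- The inclusion of the triples `(d, f, e)` with `d f e = f` into all triples. -/
def intcα : M.intArr ⟶ M.triples :=
  Sigma.desc fun p : M.carrier × M.carrier => M.splitArrι p.1 p.2 ≫ M.triplesι p.1 p.2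

lemma arrι_intcα (a b : M.carrier) : arrι a b ≫ M.intcα = M.splitArrι a b ≫ M.triplesι a b :=
  Sigma.ι_desc (fun p : M.carrier × M.carrier => M.splitArrι p.1 p.2 ≫ M.triplesι p.1 p.2) (a, b)

lemma comp_arrι_intcα (x : T ⟶ M.splitArr a b) : (x ≫ arrι a b) ≫ M.intcα =
    lift (tgt x) (lift (mid x) (src x)) ≫ M.triplesι a b := by
  rw [Category.assoc, arrι_intcα, ← Category.assoc, comp_splitArrι]

lemma intcα_condition : M.intcα ≫ M.αTriples = M.intcα ≫ 𝟙 M.triples :=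
  intArr_ext fun a b => by
    rw [← Category.assoc, arrι_intcα, ← Category.assoc, arrι_intcα, Category.assoc,
      Category.comp_id]
    have h₁ : M.triplesι a b ≫ M.αTriples = M.αTriple a b ≫ M.triplesι a b := Sigma.ι_map _ _
    rw [h₁, ← Category.assoc, equalizer.condition, Category.comp_id]

variable [Extensive.{w} V]

variable (M) in
/-- The internal category of idempotents with its splitting. -/
abbrev int (hM : Small.{w} (𝟙_ V ⟶ M.intArr)) : CatSp.{w} V where
  toInternalCategory := M.intCat
  splitting := M.intSplitting
  canonical := intSplitting_isCanonical
  small := hM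

/-- The diagonal `a ↦ (a, a, a)` is injective on indices, and pairing a monomorphism with itself
gives a monomorphism. -/
instance : Mono M.intε :=
  haveI (a : M.carrier) : Mono (lift (M.idemι a) (M.idemι a)) :=
    mono_of_mono_fac (lift_fst (M.idemι a) (M.idemι a))
  mono_sigmaDesc (X := fun a : M.carrier => M.idem a)
    (Y := fun p : M.carrier × M.carrier × M.carrier => M.hom p.2.1 p.2.2 ⊗ M.hom p.1 p.2.1)
    (fun a => (a, a, a)) (fun _ _ h => (Prod.mk_inj.1 h).1)
    fun a => lift (M.idemι a) (M.idemι a)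

instance : Mono M.intcα :=
  mono_sigmaDesc (X := fun p : M.carrier × M.carrier => M.splitArr p.1 p.2)
    (Y := fun p : M.carrier × M.carrier => M.triple p.1 p.2)
    (fun p => p) (fun _ _ h => h) fun p => M.splitArrι p.1 p.2

/-- Locally `k` lies in one component; `αTriples` preserves components, so cancelling the injection
gives the equalizer equation of that component. -/
lemma existsUnique_intcα (k : T ⟶ M.triples) (hk : k ≫ M.αTriples = k ≫ 𝟙 M.triples) :
    ∃! l : T ⟶ M.intArr, l ≫ M.intcα = k := by
  refine existsUnique_lift_of_mono _ _ (((isCover_sigmaι _).loc k).mono fun S s ⟨⟨a, b⟩, x, hx⟩ =>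
    ?_)
  have h₁ : M.triplesι a b ≫ M.αTriples = M.αTriple a b ≫ M.triplesι a b := Sigma.ι_map _ _
  have h₂ : (x ≫ M.αTriple a b) ≫ M.triplesι a b = x ≫ M.triplesι a b := by
    have := s ≫= hk
    rw [← Category.assoc, hx, Category.comp_id, hx] at this
    rw [Category.assoc, ← h₁, ← this, Category.assoc]
  have h₃ := sigmaι_cancel (X := fun p : M.carrier × M.carrier => M.triple p.1 p.2) (i := (a, b)) h₂
  refine ⟨equalizer.lift x (by rw [h₃, Category.comp_id]) ≫ arrι a b, ?_⟩
  rw [Category.assoc, arrι_intcα, ← Category.assoc, equalizer.lift_ι, hx]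

/-- Locally `k` is a pair of g from b to c and f from a to b. The equation g = g f in the coproduct
of the hom-objects forces a = b locally, and f = g f forces b = c. What remains is f = g = g f, an
idempotent paired with itself. -/
lemma existsUnique_intε (k : T ⟶ M.pairs) (h : k ≫ M.pairsFst = k ≫ M.pairsComp)
    (h' : k ≫ M.pairsSnd = k ≫ M.pairsComp) : ∃! l : T ⟶ M.intObj, l ≫ M.intε = k := by
  refine existsUnique_lift_of_mono _ _ (((isCover_sigmaι _).loc k).bind
    fun S s ⟨⟨a, b, c⟩, x, hx⟩ => ?_)
  change S ⟶ M.hom b c ⊗ M.hom a b at x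
  have e : (x ≫ fst _ _) ≫ M.homsι b c = ((x ≫ fst _ _) ⊙ (x ≫ snd _ _)) ≫ M.homsι a c := by
    have := s ≫= h
    rw [← Category.assoc, hx, ← Category.assoc, hx] at this
    simpa [cmp, comp_lift_assoc] using this
  have e' : (x ≫ snd _ _) ≫ M.homsι a b = ((x ≫ fst _ _) ⊙ (x ≫ snd _ _)) ≫ M.homsι a c := by
    have := s ≫= h'
    rw [← Category.assoc, hx, ← Category.assoc, hx] at this
    simpa [cmp, comp_lift_assoc] using this
  refine (loc_of_comp_homsι_eq e).bind fun S' r hr => ?_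
  have e'' : (r ≫ x ≫ snd _ _) ≫ M.homsι a b =
      (r ≫ (x ≫ fst _ _) ⊙ (x ≫ snd _ _)) ≫ M.homsι a c := by
    rw [Category.assoc, e', Category.assoc]
  refine (loc_of_comp_homsι_eq e'').mono fun S'' q hq => ?_
  obtain ⟨h₁, h₂⟩ := Sigma.mk.inj_iff.1 hr
  obtain ⟨h₃, h₄⟩ := Sigma.mk.inj_iff.1 hq
  obtain ⟨rfl, -⟩ := Prod.mk_inj.1 h₁
  obtain ⟨-, rfl⟩ := Prod.mk_inj.1 h₃
  have h₅ := q ≫= eq_of_heq h₂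
  have h₆ := eq_of_heq h₄
  have h₇ : q ≫ r ≫ x ≫ snd _ _ = q ≫ r ≫ x ≫ fst _ _ := h₆.trans h₅.symm
  refine ⟨mkIdem (q ≫ r ≫ x ≫ fst _ _) ?_ ≫ objι b, ?_⟩
  · rw [comp_cmp, comp_cmp, h₇] at h₅
    exact h₅.symm
  · rw [Category.assoc, objι_intε, ← Category.assoc, comp_lift, mkIdem_ι, Category.assoc,
      Category.assoc, hx]
    simp only [← Category.assoc]
    congr 1
    ext
    · simp
    · simpa using h₇.symm

/-- The triple `f` is an arbitrary representative of `k`. Its source and target become equal in the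
coproduct because `k` is an endoarrow, and `objι a` can be cancelled. -/
lemma exists_eq_endSplit {k : T ⟶ M.intCat.idem} {f : T ⟶ M.splitArr a a} {p : T ⟶ M.idem a}
    (hk : k ≫ M.intCat.idemι = f ≫ arrι a a) (hp : p ≫ M.idemι a = mid f) :
    tgt f = src f ∧ ∃ h : Absorbs p (src f),
      k ≫ M.intCat.idemι = endSplit (src f) p h ≫ arrι a a := by
  have h₁ : tgt f = src f := objι_cancel (by
    have := k ≫= M.intCat.idemι_condition
    simp only [← Category.assoc, hk] at this
    simp only [Category.assoc, arrι_intDom, arrι_intCod] at this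
    exact this.symm)
  have h₂ : Absorbs p (src f) := ⟨by rw [hp, ← h₁, tgt_cmp_mid], by rw [hp, mid_cmp_src]⟩
  refine ⟨h₁, h₂, hk.trans ?_⟩
  congr 1
  apply split_ext
  · rw [tgt_endSplit, h₁]
  · rw [mid_endSplit, hp]
  · rw [src_endSplit]

variable (M) in
/-- The internal category of idempotents is the one constructed from `M`. -/
def intPresentation (hM : Small.{w} (𝟙_ V ⟶ M.intArr)) : IntPresentation M (M.int hM) where
  ε := M.intε
  ε_fst := intObj_ext fun a => by
    rw [← Category.assoc, objι_intε, ← Category.assoc, objι_intε]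
    simpa [cmp, comp_lift_assoc] using ((idem_cmp_idem (𝟙 (M.idem a))).symm =≫ M.homsι a a)
  ε_snd := intObj_ext fun a => by
    rw [← Category.assoc, objι_intε, ← Category.assoc, objι_intε]
    simpa [cmp, comp_lift_assoc] using ((idem_cmp_idem (𝟙 (M.idem a))).symm =≫ M.homsι a a)
  ε_universal := existsUnique_intε
  cα := M.intcα
  cα_condition := intcα_condition
  cα_isLimit := ⟨Fork.IsLimit.ofExistsUnique fun s => existsUnique_intcα s.ι s.condition⟩
  objι := objι
  objι_ε := objι_intε
  objι_isColimit := ⟨coproductIsCoproduct _⟩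
  arrι := arrι
  arrι_cα := arrι_intcα
  arrι_isColimit := ⟨coproductIsCoproduct fun p : M.carrier × M.carrier => M.splitArr p.1 p.2⟩
  dom_eq a b := by
    have := arrι_intDom (𝟙 (M.splitArr a b))
    rw [Category.id_comp] at this
    rw [this, src, Category.id_comp, Category.assoc, Category.assoc]
  cod_eq a b := by
    have := arrι_intCod (𝟙 (M.splitArr a b))
    rw [Category.id_comp] at this
    rw [this, tgt, Category.id_comp, Category.assoc]
  ident_eq a := by
    have := objι_intIdent (𝟙 (M.idem a))
    rw [Category.id_comp] at this
    rw [this, comp_arrι_intcα, src_idSplit, mid_idSplit, tgt_idSplit, Category.id_comp]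
  comp_eq a b c g f _ h := by
    rw [intCat_compose h rfl rfl, comp_arrι_intcα, src_compSplit, mid_compSplit, tgt_compSplit]
    rfl
  S_eq a k f p hk hp := by
    obtain ⟨h₁, h₂, h⟩ := exists_eq_endSplit hk hp
    rw [comp_intS h, comp_arrι_intcα, tgt_secSplit, mid_secSplit, src_secSplit, ← h₁]
    rfl
  R_eq a k f p hk hp := by
    obtain ⟨h₁, h₂, h⟩ := exists_eq_endSplit hk hp
    rw [comp_intR h, comp_arrι_intcα, tgt_retrSplit, mid_retrSplit, src_retrSplit]
    rfl

end IntFunctor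

/-! ### The action of `Int` on enriched functors -/

section IntFunctor

variable {V : Type u} [Category.{v} V] [CartesianMonoidalCategory V] [HasFiniteLimits V]
  {M N K : VCat.{w} V} {T S : V} {a b c : M.carrier}

local infixr:80 " ⊙ " => VCat.cmp

@[simp]
lemma comp_idemMap_ι (F : M ⟶ N) (e : T ⟶ M.idem a) :
    (e ≫ idemMap F a) ≫ N.idemι (F.obj a) = (e ≫ M.idemι a) ≫ F.map a a := by
  rw [Category.assoc, Category.assoc, idemMap, equalizer.lift_ι]

/-- The image `(F d, F f, F e)` of a triple `(d, f, e)`. -/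
def mapSplit (F : M ⟶ N) (x : T ⟶ M.splitArr a b) : T ⟶ N.splitArr (F.obj a) (F.obj b) :=
  mkSplit (tgt x ≫ idemMap F b) (mid x ≫ F.map a b) (src x ≫ idemMap F a)
    (by rw [comp_idemMap_ι, ← cmp_comp_map, tgt_cmp_mid])
    (by rw [comp_idemMap_ι, ← cmp_comp_map, mid_cmp_src])

section

variable (F : M ⟶ N) (x : T ⟶ M.splitArr a b)

@[simp] lemma src_mapSplit : src (mapSplit F x) = src x ≫ idemMap F a := src_mkSplit ..
@[simp] lemma mid_mapSplit : mid (mapSplit F x) = mid x ≫ F.map a b := mid_mkSplit ..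
@[simp] lemma tgt_mapSplit : tgt (mapSplit F x) = tgt x ≫ idemMap F b := tgt_mkSplit ..

lemma comp_mapSplit (s : S ⟶ T) : s ≫ mapSplit F x = mapSplit F (s ≫ x) := by
  apply split_ext <;> simp

lemma mapSplit_compSplit (g : T ⟶ M.splitArr b c) :
    mapSplit F (compSplit g x) = compSplit (mapSplit F g) (mapSplit F x) := by
  apply split_ext <;> simp

lemma mapSplit_idSplit (e : T ⟶ M.idem a) :
    mapSplit F (idSplit e) = idSplit (e ≫ idemMap F a) := by
  apply split_ext
  · simp
  · rw [mid_mapSplit, mid_idSplit, mid_idSplit, comp_idemMap_ι]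
  · simp

end

lemma Absorbs.map {p e : T ⟶ M.idem a} (h : Absorbs p e) (F : M ⟶ N) :
    Absorbs (p ≫ idemMap F a) (e ≫ idemMap F a) :=
  ⟨by simp only [comp_idemMap_ι, ← cmp_comp_map, h.left], by
    simp only [comp_idemMap_ι, ← cmp_comp_map, h.right]⟩

section

variable (F : M ⟶ N) (e p : T ⟶ M.idem a) (h : Absorbs p e)

lemma mapSplit_endSplit : mapSplit F (endSplit e p h) = endSplit _ _ (h.map F) := by
  apply split_ext
  · simp
  · rw [mid_mapSplit, mid_endSplit, mid_endSplit, comp_idemMap_ι]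
  · simp

lemma mapSplit_retrSplit : mapSplit F (retrSplit e p h) = retrSplit _ _ (h.map F) := by
  apply split_ext
  · simp
  · rw [mid_mapSplit, mid_retrSplit, mid_retrSplit, comp_idemMap_ι]
  · simp

lemma mapSplit_secSplit : mapSplit F (secSplit e p h) = secSplit _ _ (h.map F) := by
  apply split_ext
  · simp
  · rw [mid_mapSplit, mid_secSplit, mid_secSplit, comp_idemMap_ι]
  · simp

end

lemma idemMap_id (a : M.carrier) : idemMap (𝟙 M) a = 𝟙 (M.idem a) :=
  idem_ext (by
    have := comp_idemMap_ι (𝟙 M) (𝟙 (M.idem a))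
    rw [Category.id_comp, Category.id_comp] at this
    exact this.trans ((Category.comp_id _).trans (Category.id_comp _).symm))

lemma idemMap_comp (F : M ⟶ N) (G : N ⟶ K) (a : M.carrier) :
    idemMap (F ≫ G) a = idemMap F a ≫ idemMap G (F.obj a) :=
  idem_ext (by
    have h₁ := comp_idemMap_ι (F ≫ G) (𝟙 (M.idem a))
    have h₂ := comp_idemMap_ι F (𝟙 (M.idem a))
    rw [Category.id_comp, Category.id_comp] at h₁ h₂
    refine h₁.trans (Eq.trans ?_ (comp_idemMap_ι G (idemMap F a)).symm)
    rw [h₂, Category.assoc]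
    rfl)

lemma mapSplit_id (x : T ⟶ M.splitArr a b) : mapSplit (𝟙 M) x = x := by
  apply split_ext
  · rw [tgt_mapSplit, idemMap_id]
    exact Category.comp_id _
  · rw [mid_mapSplit]
    exact Category.comp_id _
  · rw [src_mapSplit, idemMap_id]
    exact Category.comp_id _

lemma mapSplit_comp (F : M ⟶ N) (G : N ⟶ K) (x : T ⟶ M.splitArr a b) :
    mapSplit (F ≫ G) x = mapSplit G (mapSplit F x) := by
  apply split_ext
  · refine (tgt_mapSplit _ _).trans (Eq.trans ?_ ((tgt_mapSplit G _).trans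
      (congrArg (· ≫ idemMap G (F.obj b)) (tgt_mapSplit F x))).symm)
    rw [idemMap_comp]
    exact (Category.assoc _ _ _).symm
  · refine (mid_mapSplit _ _).trans (Eq.trans ?_ ((mid_mapSplit G _).trans
      (congrArg (· ≫ G.map (F.obj a) (F.obj b)) (mid_mapSplit F x))).symm)
    exact (Category.assoc _ _ _).symm
  · refine (src_mapSplit _ _).trans (Eq.trans ?_ ((src_mapSplit G _).trans
      (congrArg (· ≫ idemMap G (F.obj a)) (src_mapSplit F x))).symm)
    rw [idemMap_comp]
    exact (Category.assoc _ _ _).symm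

variable [HasCoproducts.{w} V]

/-- The action of an enriched functor on all the idempotents. -/
def mapObj (F : M ⟶ N) : M.intObj ⟶ N.intObj := objDesc fun a => idemMap F a ≫ objι (F.obj a)

/-- The action of an enriched functor on all the triples `(d, f, e)` with `d f e = f`. -/
def mapArr (F : M ⟶ N) : M.intArr ⟶ N.intArr :=
  arrDesc fun a b => mapSplit F (𝟙 (M.splitArr a b)) ≫ arrι (F.obj a) (F.obj b)

@[simp]
lemma objι_mapObj (F : M ⟶ N) (e : T ⟶ M.idem a) :
    e ≫ objι a ≫ mapObj F = (e ≫ idemMap F a) ≫ objι (F.obj a) := by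
  rw [mapObj, objι_desc, Category.assoc]

@[simp]
lemma arrι_mapArr (F : M ⟶ N) (x : T ⟶ M.splitArr a b) :
    x ≫ arrι a b ≫ mapArr F = mapSplit F x ≫ arrι (F.obj a) (F.obj b) := by
  rw [mapArr, arrι_desc, ← Category.assoc, comp_mapSplit, Category.comp_id]

lemma comp_mapArr_of_eq (F : M ⟶ N) {s : S ⟶ T} {k : T ⟶ M.intArr} {x : S ⟶ M.splitArr a b}
    (h : s ≫ k = x ≫ arrι a b) :
    s ≫ k ≫ mapArr F = mapSplit F x ≫ arrι (F.obj a) (F.obj b) := by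
  rw [← Category.assoc, h, Category.assoc, arrι_mapArr]

/-- The redundant identity brings both sides into the shape to which the evaluations at generalized
elements, such as `objι_mapObj`, apply. -/
lemma intObj_ext' {Z : V} {f g : M.intObj ⟶ Z}
    (h : ∀ a, 𝟙 (M.idem a) ≫ objι a ≫ f = 𝟙 _ ≫ objι a ≫ g) : f = g :=
  intObj_ext fun a => by simpa only [Category.id_comp] using h a

lemma intArr_ext' {Z : V} {f g : M.intArr ⟶ Z}
    (h : ∀ a b, 𝟙 (M.splitArr a b) ≫ arrι a b ≫ f = 𝟙 _ ≫ arrι a b ≫ g) : f = g :=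
  intArr_ext fun a b => by simpa only [Category.id_comp] using h a b

variable [Extensive.{w} V]

/-- The internal functor induced by an enriched functor. -/
abbrev intMap (F : M ⟶ N) : InternalFunctor M.intCat N.intCat where
  onObj := mapObj F
  onArr := mapArr F
  dom := intArr_ext' fun a b => by
    rw [← Category.assoc (arrι a b), ← Category.assoc, arrι_mapArr, Category.assoc, arrι_intDom,
      ← Category.assoc (arrι a b), ← Category.assoc (𝟙 _), arrι_intDom, Category.assoc,
      objι_mapObj, src_mapSplit]
  cod := intArr_ext' fun a b => by
    rw [← Category.assoc (arrι a b), ← Category.assoc, arrι_mapArr, Category.assoc, arrι_intCod,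
      ← Category.assoc (arrι a b), ← Category.assoc (𝟙 _), arrι_intCod, Category.assoc,
      objι_mapObj, tgt_mapSplit]
  ident := intObj_ext' fun a => by
    rw [← Category.assoc (objι a), ← Category.assoc, objι_intIdent, Category.assoc, arrι_mapArr,
      ← Category.assoc (objι a), ← Category.assoc (𝟙 _), objι_mapObj, Category.assoc,
      objι_intIdent, mapSplit_idSplit]
  comp h := by
    refine (loc_composable _ _ pullback.condition).eq fun S s ⟨a, b, c, g, f, hg, hf, _⟩ => ?_
    rw [comp_mapArr_of_eq F (intData_comp hg hf),
      comp_intCat_compose h (comp_mapArr_of_eq F hg) (comp_mapArr_of_eq F hf), mapSplit_compSplit]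

/-- The action of `Int` on enriched functors. -/
abbrev mapInt (F : M ⟶ N) (hM : Small.{w} (𝟙_ V ⟶ M.intArr)) (hN : Small.{w} (𝟙_ V ⟶ N.intArr)) :
    M.int hM ⟶ N.int hN :=
  { intMap F with
    map_R := (loc_idem (𝟙 M.intCat.idem)).eq fun T s ⟨a, e, p, hp, h⟩ => by
      rw [Category.id_comp] at h
      have h' : (s ≫ (intMap F).onIdem) ≫ N.intCat.idemι =
          endSplit _ _ (hp.map F) ≫ arrι _ _ := by
        rw [Category.assoc, InternalFunctor.onIdem_ι, comp_mapArr_of_eq F h, mapSplit_endSplit]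
      rw [comp_mapArr_of_eq F (comp_intR h), ← Category.assoc, comp_intR h', mapSplit_retrSplit]
    map_S := (loc_idem (𝟙 M.intCat.idem)).eq fun T s ⟨a, e, p, hp, h⟩ => by
      rw [Category.id_comp] at h
      have h' : (s ≫ (intMap F).onIdem) ≫ N.intCat.idemι =
          endSplit _ _ (hp.map F) ≫ arrι _ _ := by
        rw [Category.assoc, InternalFunctor.onIdem_ι, comp_mapArr_of_eq F h, mapSplit_endSplit]
      rw [comp_mapArr_of_eq F (comp_intS h), ← Category.assoc, comp_intS h', mapSplit_secSplit] }

variable (V) in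
/-- The functor sending an enriched category to its internal category of idempotents. -/
def intFunctor (hS : ∀ M : VCat.{w} V, Small.{w} (𝟙_ V ⟶ M.intArr)) :
    VCat.{w} V ⥤ CatSp.{w} V where
  obj M := M.int (hS M)
  map {M N} F := mapInt F (hS M) (hS N)
  map_id M := CatSp.Hom.ext
    (intObj_ext' fun a => (objι_mapObj _ _).trans (by
      rw [idemMap_id]
      exact (congrArg (· ≫ objι a) (Category.comp_id (𝟙 (M.idem a)))).trans
        (congrArg (𝟙 (M.idem a) ≫ ·) (Category.comp_id (objι a)).symm)))
    (intArr_ext' fun a b => (arrι_mapArr _ _).trans (by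
      rw [mapSplit_id]
      exact congrArg (𝟙 (M.splitArr a b) ≫ ·) (Category.comp_id (arrι a b)).symm))
  map_comp F G := CatSp.Hom.ext
    (intObj_ext' fun a => (objι_mapObj _ _).trans (by
      have h : 𝟙 _ ≫ objι a ≫ mapObj F ≫ mapObj G =
          ((𝟙 _ ≫ idemMap F a) ≫ idemMap G _) ≫ objι (G.obj (F.obj a)) := by
        rw [← Category.assoc (objι a), ← Category.assoc (𝟙 _), objι_mapObj, Category.assoc,
          objι_mapObj]
      refine Eq.trans ?_ h.symm
      rw [idemMap_comp]
      exact congrArg (· ≫ objι (G.obj (F.obj a))) (Category.assoc _ _ _).symm))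
    (intArr_ext' fun a b => (arrι_mapArr _ _).trans (by
      have h : 𝟙 _ ≫ arrι a b ≫ mapArr F ≫ mapArr G =
          mapSplit G (mapSplit F (𝟙 _)) ≫ arrι (G.obj (F.obj a)) (G.obj (F.obj b)) := by
        rw [← Category.assoc (arrι a b), ← Category.assoc (𝟙 _), arrι_mapArr, Category.assoc,
          arrι_mapArr]
      refine Eq.trans ?_ h.symm
      rw [mapSplit_comp]
      rfl))

lemma isIntMap_mapInt (F : M ⟶ N) (hM : Small.{w} (𝟙_ V ⟶ M.intArr))
    (hN : Small.{w} (𝟙_ V ⟶ N.intArr)) :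
    IsIntMap (M.intPresentation hM) (N.intPresentation hN) F (mapInt F hM hN) where
  onObj_eq a := objι_desc _ _
  onArr_eq a b := by
    refine (congrArg (· ≫ N.intcα) ((Category.id_comp _).symm.trans
      (arrι_mapArr F (𝟙 (M.splitArr a b))))).trans ((comp_arrι_intcα _).trans ?_)
    congr 1
    rw [src_mapSplit, mid_mapSplit, tgt_mapSplit, tripleMap]
    ext <;> simp [src, mid, tgt]

end IntFunctor

end VCat

/-! ## Generalized objects and arrows of an internal category -/

namespace InternalCategory

section Generalized

variable {V : Type u} [Category.{v} V] [HasFiniteLimits V] (A : InternalCategory V) {T S : V}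

variable (T) in
/-- The generalized objects of `A` at stage `T`. -/
def GObj : Type v := T ⟶ A.obj

/-- The generalized arrows of `A` between two generalized objects. -/
@[ext]
structure GArr (X Y : T ⟶ A.obj) where
  arr : T ⟶ A.arr
  dom : arr ≫ A.dom = X
  cod : arr ≫ A.cod = Y

variable {A} in
/-- The identity of a generalized object. -/
def GArr.ident (X : T ⟶ A.obj) : A.GArr X X :=
  ⟨X ≫ A.ident, by simp [A.ident_dom], by simp [A.ident_cod]⟩

/-- The computations with splittings take place in this ordinary category. Its composition is
diagrammatic, so `f ≫ g` is "`g` after `f`" and the two unit laws exchange roles. -/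
instance : Category.{v} (A.GObj T) where
  Hom X Y := A.GArr X Y
  id X := GArr.ident X
  comp f g := ⟨A.compose g.arr f.arr (g.dom.trans f.cod.symm), by rw [compose_dom, f.dom],
    by rw [compose_cod, g.cod]⟩
  id_comp f := GArr.ext (A.compose_ident _ _ _ (by rw [← Category.assoc, f.dom]; rfl))
  comp_id f := GArr.ext (A.ident_compose _ _ _ (by rw [← Category.assoc, f.cod]; rfl))
  assoc f g h := GArr.ext (A.assoc _ _ _ _ _ _ _).symm

variable {A}

lemma GArr.hom_ext {X Y : A.GObj T} {f g : X ⟶ Y} (h : f.arr = g.arr) : f = g := GArr.ext h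

lemma GArr.id_arr (X : A.GObj T) : (𝟙 X : X ⟶ X).arr = (show T ⟶ A.obj from X) ≫ A.ident := rfl

lemma GArr.comp_arr {X Y Z : A.GObj T} (f : X ⟶ Y) (g : Y ⟶ Z) :
    (f ≫ g).arr = A.compose g.arr f.arr (g.dom.trans f.cod.symm) := rfl

/-- A generalized idempotent as a generalized element of the object of idempotents. -/
def toIdem {X : A.GObj T} (e : X ⟶ X) (he : e ≫ e = e) : T ⟶ A.idem :=
  A.idemLift e.arr (e.dom.trans e.cod.symm) (congrArg GArr.arr he)

@[simp]
lemma toIdem_ι {X : A.GObj T} (e : X ⟶ X) (he : e ≫ e = e) : toIdem e he ≫ A.idemι = e.arr :=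
  idemLift_ι _ _ _ _

lemma eq_toIdem {X : A.GObj T} {e : X ⟶ X} (he : e ≫ e = e) {k : T ⟶ A.idem}
    (hk : k ≫ A.idemι = e.arr) : k = toIdem e he :=
  A.idem_hom_ext (by rw [hk, toIdem_ι])

variable (σ : A.Splitting)

/-! ### Split generalized idempotents and the canonicity axioms -/

namespace Splitting

variable {X : A.GObj T} (e : X ⟶ X) (he : e ≫ e = e)

/-- The generalized object through which a generalized idempotent splits. -/
def img : A.GObj T := toIdem e he ≫ σ.S ≫ A.dom

/-- The retraction of a generalized idempotent. -/
def retr : X ⟶ σ.img e he :=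
  ⟨toIdem e he ≫ σ.R, by
    rw [Category.assoc, σ.R_dom, ← Category.assoc, toIdem_ι, e.dom], by
    rw [Category.assoc, σ.R_cod]; rfl⟩

/-- The section of a generalized idempotent. -/
def sect : σ.img e he ⟶ X :=
  ⟨toIdem e he ≫ σ.S, by rw [Category.assoc]; rfl, by
    rw [Category.assoc, σ.S_cod, ← Category.assoc, toIdem_ι, e.dom]⟩

lemma retr_arr : (σ.retr e he).arr = toIdem e he ≫ σ.R := rfl

lemma sect_arr : (σ.sect e he).arr = toIdem e he ≫ σ.S := rfl

lemma retr_sect : σ.retr e he ≫ σ.sect e he = e :=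
  GArr.hom_ext (by
    rw [GArr.comp_arr]
    exact (A.comp_compose _ _ _ σ.R_cod.symm).symm.trans
      ((toIdem e he ≫= σ.S_comp_R _).trans (toIdem_ι _ _)))

lemma sect_retr : σ.sect e he ≫ σ.retr e he = 𝟙 _ :=
  GArr.hom_ext (by
    rw [GArr.comp_arr]
    exact (A.comp_compose _ _ _ (σ.R_dom.trans σ.S_cod.symm)).symm.trans
      ((toIdem e he ≫= σ.R_comp_S _).trans (by
        rw [GArr.id_arr, img, ← Category.assoc, Category.assoc])))

lemma retr_sect_assoc {Y : A.GObj T} (f : X ⟶ Y) :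
    σ.retr e he ≫ σ.sect e he ≫ f = e ≫ f := by
  rw [← Category.assoc, retr_sect]

lemma sect_retr_assoc {Y : A.GObj T} (f : σ.img e he ⟶ Y) :
    σ.sect e he ≫ σ.retr e he ≫ f = f := by
  rw [← Category.assoc, sect_retr, Category.id_comp]

variable {σ e he}

/-- The idempotent factors through `identIdem`. Underlying arrows are compared because `img` is only
propositionally equal to `X`. -/
lemma IsCanonical.retr_of_eq_id (hσ : σ.IsCanonical) (h : e = 𝟙 X) :
    (σ.retr e he).arr = (𝟙 X : X ⟶ X).arr := by
  have : toIdem e he = (show T ⟶ A.obj from X) ≫ A.identIdem :=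
    A.idem_hom_ext (by rw [toIdem_ι, Category.assoc, identIdem, idemLift_ι, h]; rfl)
  rw [retr_arr, this, Category.assoc, hσ.ident_R, GArr.id_arr]

lemma IsCanonical.sect_of_eq_id (hσ : σ.IsCanonical) (h : e = 𝟙 X) :
    (σ.sect e he).arr = (𝟙 X : X ⟶ X).arr := by
  have : toIdem e he = (show T ⟶ A.obj from X) ≫ A.identIdem :=
    A.idem_hom_ext (by rw [toIdem_ι, Category.assoc, identIdem, idemLift_ι, h]; rfl)
  rw [sect_arr, this, Category.assoc, hσ.ident_S, GArr.id_arr]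

variable {g : X ⟶ X} {hg : g ≫ g = g} {k : T ⟶ A.idem}

/-- The canonicity axiom carried over to the category of generalized objects, where the proofs of
composability disappear from the statement. -/
lemma IsCanonical.comp_R (hσ : σ.IsCanonical) (h : e ≫ g ≫ e = g)
    (hk : k ≫ A.idemι = (σ.sect e he ≫ g ≫ σ.retr e he).arr) :
    k ≫ σ.R = (σ.sect e he ≫ σ.retr g hg).arr := by
  -- In diagrammatic order the bracketing on the left is the one that unfolds to the nested
  -- `compose` of the axiom.
  rw [← Category.assoc] at h hk
  have hfι := toIdem_ι e he
  have hgι := toIdem_ι g hg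
  refine hσ.R_eq (toIdem e he) (toIdem g hg) k ?_ ?_ ?_ ?_ ?_ ?_
    ((A.compose_congr _ hfι (A.compose_congr _ hgι hfι)).trans
      ((congrArg GArr.arr h).trans hgι.symm)) (hk.trans ?_)
  · rw [hfι, hgι, e.dom, g.cod]
  · rw [hfι, hgι, g.dom, e.cod]
  · rw [compose_cod, hfι, hgι, e.dom, g.cod]
  · rw [hgι, g.dom, ← sect_arr, (σ.sect e he).cod]
  · rw [compose_cod, hgι, g.cod, ← retr_arr, (σ.retr e he).dom]
  · exact A.compose_congr _ rfl (A.compose_congr _ hgι.symm rfl)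

lemma IsCanonical.comp_S (hσ : σ.IsCanonical) (h : e ≫ g ≫ e = g)
    (hk : k ≫ A.idemι = (σ.sect e he ≫ g ≫ σ.retr e he).arr) :
    k ≫ σ.S = (σ.sect g hg ≫ σ.retr e he).arr := by
  rw [← Category.assoc] at h hk
  have hfι := toIdem_ι e he
  have hgι := toIdem_ι g hg
  refine hσ.S_eq (toIdem e he) (toIdem g hg) k ?_ ?_ ?_ ?_ ?_ ?_
    ((A.compose_congr _ hfι (A.compose_congr _ hgι hfι)).trans
      ((congrArg GArr.arr h).trans hgι.symm)) (hk.trans ?_)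
  · rw [hfι, hgι, e.dom, g.cod]
  · rw [hfι, hgι, g.dom, e.cod]
  · rw [compose_cod, hfι, hgι, e.dom, g.cod]
  · rw [hgι, g.dom, ← sect_arr, (σ.sect e he).cod]
  · rw [compose_cod, hgι, g.cod, ← retr_arr, (σ.retr e he).dom]
  · exact A.compose_congr _ rfl (A.compose_congr _ hgι.symm rfl)

end Splitting

end Generalized

end InternalCategory

namespace VCat

/-! ## Extension of enriched functors to internal functors -/

section Extension

open InternalCategory

variable {V : Type u} [Category.{v} V] [CartesianMonoidalCategory V] [HasFiniteLimits V]
  {M : VCat.{w} V} {A : CatSp.{w} V} (F : EnrichedFunctor V M.carrier A.Points)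
  {T S : V} {a b c : M.carrier}

local infixr:80 " ⊙ " => VCat.cmp

variable (T) in
/-- The image of an object under an enriched functor, as a generalized object. -/
def gObj (a : M.carrier) : A.GObj T := toUnit T ≫ (F.obj a).pt

/-- The image of an arrow under an enriched functor, as a generalized arrow. -/
def gMap (f : T ⟶ a ⟶[V] b) : gObj F T a ⟶ gObj F T b :=
  ⟨(f ≫ F.map a b) ≫ A.up (F.obj a).pt (F.obj b).pt, A.comp_up_dom _, A.comp_up_cod _⟩

lemma gMap_arr (f : T ⟶ a ⟶[V] b) :
    (gMap F f).arr = (f ≫ F.map a b) ≫ A.up (F.obj a).pt (F.obj b).pt := rfl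

lemma comp_gMap_arr (s : S ⟶ T) (f : T ⟶ a ⟶[V] b) :
    s ≫ (gMap F f).arr = (gMap F (s ≫ f)).arr := by
  simp only [gMap_arr, Category.assoc]

lemma gMap_cmp (g : T ⟶ b ⟶[V] c) (f : T ⟶ a ⟶[V] b) :
    gMap F (g ⊙ f) = gMap F f ≫ gMap F g :=
  GArr.hom_ext (by
    have h₁ : (g ⊙ f) ≫ F.map a c = lift (f ≫ F.map a b) (g ≫ F.map b c) ≫
        A.Γcomp (F.obj a).pt (F.obj b).pt (F.obj c).pt :=
      cmp_comp_map (N := A.toVCat) F g f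
    rw [gMap_arr, h₁, comp_Γcomp_up, GArr.comp_arr]
    exact A.compose_congr _ (congrArg (· ≫ A.up _ _) (lift_snd (f ≫ F.map a b) (g ≫ F.map b c)))
      (congrArg (· ≫ A.up _ _) (lift_fst (f ≫ F.map a b) (g ≫ F.map b c))))

lemma gMap_one : gMap F (one T a) = 𝟙 (gObj F T a) :=
  GArr.hom_ext (by
    have h₁ : one T a ≫ F.map a a = toUnit T ≫ A.Γident (F.obj a).pt :=
      one_comp_map (N := A.toVCat) F
    rw [gMap_arr, h₁, Category.assoc, Γident, Γlift_up, GArr.id_arr, ← Category.assoc]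
    rfl)

lemma gMap_idem (e : T ⟶ M.idem a) :
    gMap F (e ≫ M.idemι a) ≫ gMap F (e ≫ M.idemι a) = gMap F (e ≫ M.idemι a) := by
  rw [← gMap_cmp, idem_cmp_idem]

/-- The retraction of the image of a generalized idempotent. -/
def gRetr (e : T ⟶ M.idem a) := A.splitting.retr (gMap F (e ≫ M.idemι a)) (gMap_idem F e)

/-- The section of the image of a generalized idempotent. -/
def gSect (e : T ⟶ M.idem a) := A.splitting.sect (gMap F (e ≫ M.idemι a)) (gMap_idem F e)

lemma comp_toIdem_gMap (s : S ⟶ T) (e : T ⟶ M.idem a) :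
    s ≫ toIdem (gMap F (e ≫ M.idemι a)) (gMap_idem F e) =
      toIdem (gMap F ((s ≫ e) ≫ M.idemι a)) (gMap_idem F (s ≫ e)) :=
  eq_toIdem _ (by rw [Category.assoc, toIdem_ι, comp_gMap_arr, Category.assoc])

lemma comp_gRetr_arr (s : S ⟶ T) (e : T ⟶ M.idem a) :
    s ≫ (gRetr F e).arr = (gRetr F (s ≫ e)).arr := by
  rw [gRetr, gRetr, Splitting.retr_arr, ← Category.assoc, comp_toIdem_gMap]
  rfl

lemma comp_gSect_arr (s : S ⟶ T) (e : T ⟶ M.idem a) :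
    s ≫ (gSect F e).arr = (gSect F (s ≫ e)).arr := by
  rw [gSect, gSect, Splitting.sect_arr, ← Category.assoc, comp_toIdem_gMap]
  rfl

/-- The generalized arrow `r_{F d} (F f) s_{F e}`. -/
def extEl (d : T ⟶ M.idem b) (f : T ⟶ a ⟶[V] b) (e : T ⟶ M.idem a) :=
  gSect F e ≫ gMap F f ≫ gRetr F d

/-- The generalized object through which the image of an idempotent splits. -/
def extObjEl (e : T ⟶ M.idem a) : A.GObj T :=
  A.splitting.img (gMap F (e ≫ M.idemι a)) (gMap_idem F e)

lemma comp_extEl_arr (s : S ⟶ T) (d : T ⟶ M.idem b) (f : T ⟶ a ⟶[V] b) (e : T ⟶ M.idem a) :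
    s ≫ (extEl F d f e).arr = (extEl F (s ≫ d) (s ≫ f) (s ≫ e)).arr := by
  rw [extEl, GArr.comp_arr, A.comp_compose]
  refine A.compose_congr _ ?_ (comp_gSect_arr F s e)
  rw [GArr.comp_arr, A.comp_compose]
  exact A.compose_congr _ (comp_gRetr_arr F s d) (comp_gMap_arr F s f)

/-- The object is the domain of the section, so its stability follows from that of `gSect`. -/
lemma comp_extObjEl (s : S ⟶ T) (e : T ⟶ M.idem a) :
    s ≫ (show T ⟶ A.obj from extObjEl F e) = extObjEl F (s ≫ e) := by
  have h₁ := s ≫= (gSect F e).dom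
  have h₂ := (gSect F (s ≫ e)).dom
  rw [← comp_gSect_arr, Category.assoc] at h₂
  exact h₁.symm.trans h₂

/-- In the middle of the composite, the retraction followed by the section of F d is F d itself,
which F g absorbs by `h`. -/
lemma extEl_comp_extEl {d : T ⟶ M.idem b} {k : T ⟶ M.idem c} {g : T ⟶ b ⟶[V] c}
    (f : T ⟶ a ⟶[V] b) (e : T ⟶ M.idem a) (h : g ⊙ (d ≫ M.idemι b) = g) :
    extEl F d f e ≫ extEl F k g d = extEl F k (g ⊙ f) e := by
  have h₁ : gRetr F d ≫ gSect F d ≫ gMap F g ≫ gRetr F k = gMap F g ≫ gRetr F k := by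
    rw [gRetr, gSect, Splitting.retr_sect_assoc, ← Category.assoc, ← gMap_cmp, h]
  rw [extEl, extEl, extEl, gMap_cmp]
  simp only [Category.assoc]
  rw [h₁]

lemma extEl_idem (e : T ⟶ M.idem a) : extEl F e (e ≫ M.idemι a) e = 𝟙 _ := by
  rw [extEl]
  -- Only the middle factor is rewritten, since the objects at both ends depend on the same
  -- idempotent.
  conv_lhs => enter [2, 1]; rw [← A.splitting.retr_sect _ (gMap_idem F e)]
  rw [gSect, gRetr, Category.assoc, Splitting.sect_retr_assoc, Splitting.sect_retr]

/-- Splitting F p in the middle makes its section cancel against the retraction. What is left is the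
retraction that canonicity prescribes for the image of (e, p, e). -/
lemma extEl_retr {e p : T ⟶ M.idem a} :
    extEl F p (p ≫ M.idemι a) e = gSect F e ≫ gRetr F p := by
  rw [extEl]
  conv_lhs => enter [2, 1]; rw [← A.splitting.retr_sect _ (gMap_idem F p)]
  rw [gRetr, Category.assoc, Splitting.sect_retr, Category.comp_id]

lemma extEl_sect {e p : T ⟶ M.idem a} :
    extEl F e (p ≫ M.idemι a) p = gSect F p ≫ gRetr F e := by
  rw [extEl]
  conv_lhs => enter [2, 1]; rw [← A.splitting.retr_sect _ (gMap_idem F p)]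
  rw [gSect, Category.assoc, Splitting.sect_retr_assoc]

variable [HasCoproducts.{w} V]

/-- The extension on all the idempotents. -/
def extObj : M.intObj ⟶ A.obj := objDesc fun a => extObjEl F (𝟙 (M.idem a))

/-- The extension on all the triples `(d, f, e)` with `d f e = f`. -/
def extArr : M.intArr ⟶ A.arr := arrDesc fun a b =>
  (extEl F (tgt (𝟙 (M.splitArr a b))) (mid (𝟙 (M.splitArr a b))) (src (𝟙 (M.splitArr a b)))).arr

lemma objι_extObj (e : T ⟶ M.idem a) : e ≫ objι a ≫ extObj F = extObjEl F e := by
  refine (e ≫= objι_desc (fun a => show M.idem a ⟶ A.obj from extObjEl F (𝟙 (M.idem a))) a).trans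
    ?_
  exact (comp_extObjEl F e _).trans (by rw [Category.comp_id])

lemma arrι_extArr (x : T ⟶ M.splitArr a b) :
    x ≫ arrι a b ≫ extArr F = (extEl F (tgt x) (mid x) (src x)).arr := by
  rw [extArr, arrι_desc, comp_extEl_arr, ← tgt_comp, ← mid_comp, ← src_comp, Category.comp_id]

lemma comp_extArr_of_eq {s : S ⟶ T} {k : T ⟶ M.intArr} {x : S ⟶ M.splitArr a b}
    (h : s ≫ k = x ≫ arrι a b) :
    s ≫ k ≫ extArr F = (extEl F (tgt x) (mid x) (src x)).arr := by
  rw [← Category.assoc, h, Category.assoc, arrι_extArr]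

variable [Extensive.{w} V]

/-- The internal functor extending an enriched functor. -/
abbrev extFunctor : InternalFunctor M.intCat A.toInternalCategory where
  onObj := extObj F
  onArr := extArr F
  dom := intArr_ext' fun a b => by
    rw [← Category.assoc (arrι a b), ← Category.assoc, arrι_extArr,
      ← Category.assoc (arrι a b), ← Category.assoc (𝟙 _), arrι_intDom, Category.assoc,
      objι_extObj]
    exact GArr.dom _
  cod := intArr_ext' fun a b => by
    rw [← Category.assoc (arrι a b), ← Category.assoc, arrι_extArr,
      ← Category.assoc (arrι a b), ← Category.assoc (𝟙 _), arrι_intCod, Category.assoc,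
      objι_extObj]
    exact GArr.cod _
  ident := intObj_ext' fun a => by
    rw [← Category.assoc (objι a), ← Category.assoc, objι_intIdent, Category.assoc, arrι_extArr,
      ← Category.assoc (objι a), ← Category.assoc (𝟙 _), objι_extObj, tgt_idSplit, mid_idSplit,
      src_idSplit, extEl_idem]
    rfl
  comp h := by
    refine (loc_composable _ _ pullback.condition).eq fun S s ⟨a, b, c, g, f, hg, hf, hgf⟩ => ?_
    rw [comp_extArr_of_eq F (intData_comp hg hf), A.comp_compose]
    rw [tgt_compSplit, mid_compSplit, src_compSplit,
      ← extEl_comp_extEl (d := src g) F _ _ (mid_cmp_src g), GArr.comp_arr]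
    refine A.compose_congr _ (comp_extArr_of_eq F hg).symm ?_
    rw [comp_extArr_of_eq F hf, hgf]

/-- The extension of an enriched functor preserves the splittings. -/
def ext (hM : Small.{w} (𝟙_ V ⟶ M.intArr)) : M.int hM ⟶ A :=
  { extFunctor F with
    map_R := (loc_idem (𝟙 M.intCat.idem)).eq fun T s ⟨a, e, p, hp, h⟩ => by
      rw [Category.id_comp] at h
      have h' : (s ≫ (extFunctor F).onIdem) ≫ A.idemι =
          (gSect F e ≫ gMap F (p ≫ M.idemι a) ≫ gRetr F e).arr := by
        rw [Category.assoc, InternalFunctor.onIdem_ι, comp_extArr_of_eq F h, tgt_endSplit,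
          mid_endSplit, src_endSplit]
        rfl
      -- The hypothesis f g f = g of canonicity, with F e for f and F p for g.
      have h'' : gMap F (e ≫ M.idemι a) ≫ gMap F (p ≫ M.idemι a) ≫ gMap F (e ≫ M.idemι a) =
          gMap F (p ≫ M.idemι a) := by
        rw [← gMap_cmp, ← gMap_cmp, hp.left, hp.right]
      rw [comp_extArr_of_eq F (comp_intR h), ← Category.assoc, tgt_retrSplit, mid_retrSplit,
        src_retrSplit, extEl_retr]
      exact (A.canonical.comp_R h'' h').symm
    map_S := (loc_idem (𝟙 M.intCat.idem)).eq fun T s ⟨a, e, p, hp, h⟩ => by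
      rw [Category.id_comp] at h
      have h' : (s ≫ (extFunctor F).onIdem) ≫ A.idemι =
          (gSect F e ≫ gMap F (p ≫ M.idemι a) ≫ gRetr F e).arr := by
        rw [Category.assoc, InternalFunctor.onIdem_ι, comp_extArr_of_eq F h, tgt_endSplit,
          mid_endSplit, src_endSplit]
        rfl
      have h'' : gMap F (e ≫ M.idemι a) ≫ gMap F (p ≫ M.idemι a) ≫ gMap F (e ≫ M.idemι a) =
          gMap F (p ≫ M.idemι a) := by
        rw [← gMap_cmp, ← gMap_cmp, hp.left, hp.right]
      rw [comp_extArr_of_eq F (comp_intS h), ← Category.assoc, tgt_secSplit, mid_secSplit,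
        src_secSplit, extEl_sect]
      exact (A.canonical.comp_S h'' h').symm }

end Extension

end VCat

lemma InternalCategory.Γident_up {V : Type u} [Category.{v} V] [CartesianMonoidalCategory V]
    [HasFiniteLimits V] (A : InternalCategory V) (α : 𝟙_ V ⟶ A.obj) :
    A.Γident α ≫ A.up α α = α ≫ A.ident :=
  A.Γlift_up _ _ _

namespace VCat

/-! ## The adjunction -/

section Unit

open InternalCategory CatSp

variable {V : Type u} [Category.{v} V] [CartesianMonoidalCategory V] [HasFiniteLimits V]
  {M N : VCat.{w} V} {A : CatSp.{w} V} {T S : V} {a b c : M.carrier}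

local infixr:80 " ⊙ " => VCat.cmp

/-- The triple `(1, f, 1)`. -/
def unitSplit (f : T ⟶ a ⟶[V] b) : T ⟶ M.splitArr a b :=
  mkSplit (oneIdem T b) f (oneIdem T a) (by simp) (by simp)

@[simp] lemma src_unitSplit (f : T ⟶ a ⟶[V] b) : src (unitSplit f) = oneIdem T a := src_mkSplit ..
@[simp] lemma mid_unitSplit (f : T ⟶ a ⟶[V] b) : mid (unitSplit f) = f := mid_mkSplit ..
@[simp] lemma tgt_unitSplit (f : T ⟶ a ⟶[V] b) : tgt (unitSplit f) = oneIdem T b := tgt_mkSplit ..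

lemma comp_unitSplit (s : S ⟶ T) (f : T ⟶ a ⟶[V] b) :
    s ≫ unitSplit f = unitSplit (s ≫ f) := by
  apply split_ext <;> simp

lemma compSplit_unitSplit (g : T ⟶ b ⟶[V] c) (f : T ⟶ a ⟶[V] b) :
    compSplit (unitSplit g) (unitSplit f) = unitSplit (g ⊙ f) := by
  apply split_ext <;> simp

lemma oneIdem_comp_idemMap (F : M ⟶ N) :
    oneIdem T a ≫ idemMap F a = oneIdem T (F.obj a) :=
  idem_ext (by rw [comp_idemMap_ι, oneIdem_ι, oneIdem_ι, one_comp_map])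

lemma mapSplit_unitSplit (F : M ⟶ N) (f : T ⟶ a ⟶[V] b) :
    mapSplit F (unitSplit f) = unitSplit (f ≫ F.map a b) := by
  apply split_ext <;> simp [oneIdem_comp_idemMap]

lemma absorbs_oneIdem (e : T ⟶ M.idem a) : Absorbs e (oneIdem T a) := ⟨by simp, by simp⟩

lemma endSplit_oneIdem (e : T ⟶ M.idem a) :
    endSplit (oneIdem T a) e (absorbs_oneIdem e) = unitSplit (e ≫ M.idemι a) := by
  apply split_ext <;> simp

/-- The factorization (d, f, e) = (d, d, 1)(1, f, 1)(1, e, e), on which the uniqueness of extensions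
rests. -/
lemma eq_compSplit_unitSplit (x : T ⟶ M.splitArr a b) :
    compSplit (retrSplit (oneIdem T b) (tgt x) (absorbs_oneIdem _))
      (compSplit (unitSplit (mid x)) (secSplit (oneIdem T a) (src x) (absorbs_oneIdem _))) = x := by
  apply split_ext <;> simp

lemma gMap_oneIdem (F : EnrichedFunctor V M.carrier A.Points) (a : M.carrier) :
    gMap F (oneIdem T a ≫ M.idemι a) = 𝟙 _ := by
  rw [oneIdem_ι, gMap_one]

/-- F preserves the identity, and a canonical splitting splits identities through themselves. This
is what makes the extension agree with F strictly on objects. -/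
lemma extObjEl_oneIdem (F : EnrichedFunctor V M.carrier A.Points) (a : M.carrier) :
    extObjEl F (oneIdem T a) = toUnit T ≫ (F.obj a).pt := by
  have h := (gSect F (oneIdem T a)).dom
  rw [gSect, A.canonical.sect_of_eq_id (gMap_oneIdem F a)] at h
  exact h.symm.trans (GArr.dom _)

lemma extEl_oneIdem (F : EnrichedFunctor V M.carrier A.Points) (f : T ⟶ a ⟶[V] b) :
    (extEl F (oneIdem T b) f (oneIdem T a)).arr = (gMap F f).arr := by
  have h₁ := A.canonical.sect_of_eq_id (gMap_oneIdem (T := T) F a)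
    (he := gMap_idem F (oneIdem T a))
  have h₂ := A.canonical.retr_of_eq_id (gMap_oneIdem (T := T) F b)
    (he := gMap_idem F (oneIdem T b))
  calc _ = (𝟙 _ ≫ gMap F f ≫ 𝟙 _ : gObj F T a ⟶ gObj F T b).arr :=
        A.compose_congr _ (A.compose_congr _ h₂ rfl) h₁
    _ = _ := by rw [Category.id_comp, Category.comp_id]

variable [HasCoproducts.{w} V]

lemma comp_oneIdem_objι (s : S ⟶ T) (a : M.carrier) :
    s ≫ oneIdem T a ≫ objι a = oneIdem S a ≫ objι a := by
  rw [← Category.assoc, comp_oneIdem]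

lemma unitSplit_intDom (f : T ⟶ a ⟶[V] b) :
    (unitSplit f ≫ arrι a b) ≫ M.intDom = toUnit T ≫ oneIdem (𝟙_ V) a ≫ objι a := by
  rw [Category.assoc, arrι_intDom, src_unitSplit, comp_oneIdem_objι]

lemma unitSplit_intCod (f : T ⟶ a ⟶[V] b) :
    (unitSplit f ≫ arrι a b) ≫ M.intCod = toUnit T ≫ oneIdem (𝟙_ V) b ≫ objι b := by
  rw [Category.assoc, arrι_intCod, tgt_unitSplit, comp_oneIdem_objι]

variable [Extensive.{w} V] (hM : Small.{w} (𝟙_ V ⟶ M.intArr))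

variable (M) in
/-- The identity of an object as a global object of the internal category of idempotents. -/
def unitObj (a : M.carrier) : (M.int hM).Points :=
  Points.mk (A := M.int hM) (oneIdem (𝟙_ V) a ≫ objι a)

lemma unitObj_pt (a : M.carrier) : (unitObj M hM a).pt = oneIdem (𝟙_ V) a ≫ objι a :=
  Points.pt_mk _

/-- The arrow `f ↦ (1, f, 1)`. -/
def unitMap (a b : M.carrier) :
    (a ⟶[V] b) ⟶ M.intCat.Γ (unitObj M hM a).pt (unitObj M hM b).pt :=
  M.intCat.Γlift (unitSplit (𝟙 (a ⟶[V] b)) ≫ arrι a b)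
    ((unitSplit_intDom _).trans (congrArg (toUnit _ ≫ ·) (unitObj_pt hM a).symm))
    ((unitSplit_intCod _).trans (congrArg (toUnit _ ≫ ·) (unitObj_pt hM b).symm))

lemma comp_unitMap_up (f : T ⟶ a ⟶[V] b) :
    (f ≫ unitMap hM a b) ≫ M.intCat.up (unitObj M hM a).pt (unitObj M hM b).pt =
      unitSplit f ≫ arrι a b := by
  rw [Category.assoc, unitMap, Γlift_up, ← Category.assoc, comp_unitSplit, Category.comp_id]

variable (M) in
/-- The unit of the adjunction. -/
def unit : M ⟶ (M.int hM).toVCat :=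
  show EnrichedFunctor V M.carrier (M.int hM).Points from
  { obj := unitObj M hM
    map := unitMap hM
    map_id := fun a => M.intCat.Γ_hom_ext (by
      refine (comp_unitMap_up hM _).trans (Eq.trans ?_ (M.intCat.Γident_up _).symm)
      have h : (unitObj M hM a).pt ≫ M.intIdent = idSplit (oneIdem (𝟙_ V) a) ≫ arrι a a := by
        rw [unitObj_pt, Category.assoc, objι_intIdent]
      refine Eq.trans ?_ h.symm
      congr 1
      apply split_ext <;> simp [eId_eq_one])
    map_comp := fun a b c => M.intCat.Γ_hom_ext (by
      refine (comp_unitMap_up hM _).trans (Eq.trans ?_ (M.intCat.comp_Γcomp_up _).symm)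
      rw [eComp_eq_cmp, ← compSplit_unitSplit]
      refine (intCat_compose _ ?_ ?_).symm
      · rw [← comp_unitMap_up hM]
        congr 1
        exact tensorHom_snd _ _
      · rw [← comp_unitMap_up hM]
        congr 1
        exact tensorHom_fst _ _) }

/-- Transposes can be compared through their underlying arrows in `A.arr`, without transport along
equalities between objects. -/
lemma unit_comp_En_up (G : M.int hM ⟶ A) (f : T ⟶ a ⟶[V] b) :
    (f ≫ (M.unit hM ≫ (En.{w} V).map G).map a b) ≫
      A.up ((M.unit hM ≫ (En.{w} V).map G).obj a).pt ((M.unit hM ≫ (En.{w} V).map G).obj b).pt =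
      unitSplit f ≫ arrι a b ≫ G.onArr := by
  have h₁ := comp_unitMap_up hM f =≫ G.onArr
  rw [Category.assoc (unitSplit f)] at h₁
  refine Eq.trans ?_ h₁
  refine (Category.assoc _ _ _).trans (Eq.trans ?_ ((Category.assoc _ _ _).trans
    (Category.assoc _ _ _)).symm)
  congr 1
  refine (Category.assoc _ _ _).trans ?_
  congr 1
  exact InternalFunctor.Γmap_up _ (Points.pt_mk _) (Points.pt_mk _)

lemma unit_naturality (F : M ⟶ N) (hN : Small.{w} (𝟙_ V ⟶ N.intArr)) :
    F ≫ N.unit hN = M.unit hM ≫ (En.{w} V).map (mapInt F hM hN) := by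
  refine enriched_ext (A := N.int hN) (fun a => ?_) (fun a b => ?_)
  · refine congrArg Points.mk (Eq.trans ?_ (congrArg (· ≫ mapObj F) (unitObj_pt hM a)).symm)
    rw [Category.assoc, objι_mapObj, oneIdem_comp_idemMap]
  · have h := unit_comp_En_up hM (mapInt F hM hN) (𝟙 (a ⟶[V] b))
    rw [Category.id_comp] at h
    refine Eq.trans ?_ h.symm
    refine (comp_unitMap_up hN _).trans ?_
    rw [arrι_mapArr, mapSplit_unitSplit, Category.id_comp]

lemma exists_idem_of_absorbs {e p : T ⟶ M.idem a} (h : Absorbs p e) :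
    ∃ k : T ⟶ M.intCat.idem, k ≫ M.intCat.idemι = endSplit e p h ≫ arrι a a := by
  refine ⟨M.intCat.idemLift (endSplit e p h ≫ arrι a a) ?_ ?_, idemLift_ι _ _ _ _⟩
  · rw [Category.assoc, arrι_intDom, Category.assoc, arrι_intCod, src_endSplit, tgt_endSplit]
  · rw [intCat_compose _ rfl rfl]
    congr 1
    apply split_ext <;> simp

/-- Agreement on the triples (1, f, 1) includes the idempotents (1, e, 1). Preservation of
splittings extends it to (d, d, 1) and (1, e, e), and the factorization of triples to all arrows. -/
lemma int_hom_ext {G G' : M.int hM ⟶ A}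
    (h : M.unit hM ≫ (En.{w} V).map G = M.unit hM ≫ (En.{w} V).map G') : G = G' := by
  have h₁ {T : V} {a b : M.carrier} (f : T ⟶ a ⟶[V] b) :
      unitSplit f ≫ arrι a b ≫ G.onArr = unitSplit f ≫ arrι a b ≫ G'.onArr := by
    rw [← unit_comp_En_up, ← unit_comp_En_up, h]
  have h₂ {T : V} {a : M.carrier} (e : T ⟶ M.idem a) {k : T ⟶ M.intCat.idem}
      (hk : k ≫ M.intCat.idemι = endSplit _ e (absorbs_oneIdem e) ≫ arrι a a) :
      k ≫ G.onIdem = k ≫ G'.onIdem :=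
    A.idem_hom_ext (by
      rw [Category.assoc, Category.assoc, InternalFunctor.onIdem_ι, InternalFunctor.onIdem_ι,
        ← Category.assoc, ← Category.assoc, hk, endSplit_oneIdem, Category.assoc, h₁,
        Category.assoc])
  have h₃ : G.onArr = G'.onArr := intArr_ext' fun a b => by
    set x := 𝟙 (M.splitArr a b)
    obtain ⟨k, hk⟩ := exists_idem_of_absorbs (absorbs_oneIdem (tgt x))
    obtain ⟨l, hl⟩ := exists_idem_of_absorbs (absorbs_oneIdem (src x))
    have hR : (retrSplit _ _ (absorbs_oneIdem (tgt x)) ≫ arrι b b) ≫ G.onArr =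
        (retrSplit _ _ (absorbs_oneIdem (tgt x)) ≫ arrι b b) ≫ G'.onArr := by
      rw [← comp_intR hk, Category.assoc, Category.assoc]
      refine (k ≫= G.map_R).trans (Eq.trans ?_ (k ≫= G'.map_R).symm)
      rw [← Category.assoc, h₂ _ hk, Category.assoc]
    have hS : (secSplit _ _ (absorbs_oneIdem (src x)) ≫ arrι a a) ≫ G.onArr =
        (secSplit _ _ (absorbs_oneIdem (src x)) ≫ arrι a a) ≫ G'.onArr := by
      rw [← comp_intS hl, Category.assoc, Category.assoc]
      refine (l ≫= G.map_S).trans (Eq.trans ?_ (l ≫= G'.map_S).symm)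
      rw [← Category.assoc, h₂ _ hl, Category.assoc]
    have hc₁ : (unitSplit (mid x) ≫ arrι a b) ≫ M.intDom =
        (secSplit _ _ (absorbs_oneIdem (src x)) ≫ arrι a a) ≫ M.intCod := by
      simp
    have hc₂ : (retrSplit _ _ (absorbs_oneIdem (tgt x)) ≫ arrι b b) ≫ M.intDom =
        M.intCat.compose _ _ hc₁ ≫ M.intCod := by
      rw [intCat_compose hc₁ rfl rfl]
      simp
    have hx : M.intCat.compose _ _ hc₂ = x ≫ arrι a b := by
      rw [intCat_compose hc₂ rfl (intCat_compose hc₁ rfl rfl), eq_compSplit_unitSplit]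
    rw [← Category.assoc, ← Category.assoc, ← hx]
    refine (G.compose_onArr _ _ hc₂).trans (Eq.trans ?_ (G'.compose_onArr _ _ hc₂).symm)
    refine A.compose_congr _ hR ?_
    refine (G.compose_onArr _ _ hc₁).trans (Eq.trans ?_ (G'.compose_onArr _ _ hc₁).symm)
    exact A.compose_congr _ (by rw [Category.assoc, h₁, Category.assoc]) hS
  refine CatSp.Hom.ext ?_ h₃
  -- The object part of an internal functor is recovered from its arrow part as the domain of the
  -- image of identities.
  have h₄ : G.onObj ≫ A.ident ≫ A.dom = G'.onObj ≫ A.ident ≫ A.dom := by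
    rw [← Category.assoc, ← Category.assoc, ← G.ident, ← G'.ident, h₃]
  rwa [A.ident_dom, Category.comp_id, Category.comp_id] at h₄

lemma unit_comp_ext (F : EnrichedFunctor V M.carrier A.Points) :
    M.unit hM ≫ (En.{w} V).map (ext F hM) = F := by
  refine enriched_ext (fun a => ?_) (fun a b => ?_)
  · refine Eq.trans (congrArg Points.mk ?_) (Points.mk_pt (F.obj a))
    refine (congrArg (· ≫ extObj F) (unitObj_pt hM a)).trans ?_
    rw [Category.assoc, objι_extObj, extObjEl_oneIdem, toUnit_unique (toUnit (𝟙_ V)) (𝟙 _),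
      Category.id_comp]
  · have h := unit_comp_En_up hM (ext F hM) (𝟙 (a ⟶[V] b))
    rw [Category.id_comp] at h
    refine h.trans ((arrι_extArr F _).trans ?_)
    rw [tgt_unitSplit, mid_unitSplit, src_unitSplit, extEl_oneIdem, gMap_arr, Category.id_comp]

lemma unit_comp_En_map_comp {B : CatSp.{w} V} (G : M.int hM ⟶ A) (H : A ⟶ B) :
    M.unit hM ≫ (En.{w} V).map (G ≫ H) = (M.unit hM ≫ (En.{w} V).map G) ≫ (En.{w} V).map H := by
  rw [Functor.map_comp]
  exact (Category.assoc _ _ _).symm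

variable (V) in
/-- Morphisms out of the internal category of idempotents of `M` are enriched functors
out of `M`. -/
def intEquiv (M : VCat.{w} V) (hM : Small.{w} (𝟙_ V ⟶ M.intArr)) (A : CatSp.{w} V) :
    (M.int hM ⟶ A) ≃ (M ⟶ (En.{w} V).obj A) :=
  Equiv.ofBijective (fun G => M.unit hM ≫ (En.{w} V).map G)
    ⟨fun _ _ h => int_hom_ext hM h, fun F => ⟨ext F hM, unit_comp_ext hM F⟩⟩

variable (V) in
/-- The functor `Int` is left adjoint to `En`. -/
def intAdjunction (hS : ∀ M : VCat.{w} V, Small.{w} (𝟙_ V ⟶ M.intArr)) :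
    intFunctor V hS ⊣ En.{w} V :=
  Adjunction.mkOfHomEquiv
    { homEquiv := fun M A => intEquiv V M (hS M) A
      homEquiv_naturality_left_symm := fun {M N A} F G => by
        -- Moved across the equivalence, the claim is the naturality of the unit.
        refine (Equiv.symm_apply_eq (intEquiv V M (hS M) A)).2 (Eq.symm ?_)
        have h : N.unit (hS N) ≫ (En.{w} V).map _ = G :=
          (intEquiv V N (hS N) A).apply_symm_apply G
        refine (unit_comp_En_map_comp (hS M) (mapInt F (hS M) (hS N)) _).trans ?_
        rw [← unit_naturality]
        exact (Category.assoc _ _ _).trans (congrArg (F ≫ ·) h)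
      homEquiv_naturality_right := fun {M A B} F G => unit_comp_En_map_comp (hS M) F G }

end Unit

end VCat

end IntEn

end

theorem mainTheorem1 (V : Type u) [Category.{v} V] [CartesianMonoidalCategory V]
    [HasFiniteLimits V] [HasCoproducts.{w} V] [IntEn.Extensive.{w} V]
    (hV : ∀ (I : Type w) (X : I → V), (∀ i, Small.{w} (𝟙_ V ⟶ X i)) → Small.{w} (𝟙_ V ⟶ ∐ X)) :
    ∃ (Int : IntEn.VCat.{w} V ⥤ IntEn.CatSp.{w} V)
      (P : ∀ M : IntEn.VCat.{w} V, IntEn.VCat.IntPresentation M (Int.obj M)),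
      (∀ (M N : IntEn.VCat.{w} V) (F : M ⟶ N),
        IntEn.VCat.IsIntMap (P M) (P N) F (Int.map F)) ∧
      Nonempty (Int ⊣ IntEn.En.{w} V) := by
  -- Points of the object of arrows are points of a coproduct over pairs of objects, so the size
  -- assumption on coproducts reduces smallness to the components.
  have hS (M : IntEn.VCat.{w} V) : Small.{w} (𝟙_ V ⟶ M.intArr) :=
    hV _ _ fun p => IntEn.VCat.small_splitArr p.1 p.2
  exact ⟨IntEn.VCat.intFunctor V hS, fun M => M.intPresentation (hS M),
    fun M N F => IntEn.VCat.isIntMap_mapInt F (hS M) (hS N), ⟨IntEn.VCat.intAdjunction V hS⟩⟩
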